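/- Let $K$ be a field and let $E=(E^0,E^1,s,r)$ be a finite directed graph. The Leavitt path algebra $L_K(F)$ of a graph $F$ is the associative (not necessarily unital) $K$-algebra generated by the vertices $v\in F^0$ and symbols $e,e^*$ for $e\in F^1$, subject to the following relations: the vertices are orthogonal idempotents; $s(e)e=e=er(e)$ and $r(e)e^*=e^*=e^*s(e)$; $e^*e=r(e)$, and $e^*f=0$ for edges $e\ne f$; and $v=\sum_{s(e)=v}ee^*$ for every vertex $v$ that emits a nonempty finite set of edges. It is unital, with $1=\sum_{v\in F^0}v$, when $F^0$ is finite. Let $\tau\in E^1$ be a source loop at the vertex $t$: $s(\tau)=r(\tau)=t$, and $\tau$ is the only edge $e$ with $r(e)=t$. Put $H=E^0\setminus\{t\}$ (a hereditary set of vertices), let $E_H$ be the graph with vertex set $H$ and edge set $\{e\in E^1: s(e)\in H\}$, put $\rho=\sum_{u\in H}u\in L_K(E)$, and let $I=L_K(E)\,\rho\,L_K(E)$ be the two-sided ideal generated by $\rho$. Then: 1. The ideal $I$, viewed as a $K$-algebra in its own right, is isomorphic to the Leavitt path $K$-algebra of some (not necessarily finite) graph. Further, $I$ is Morita equivalent to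 $L_K(E_H)$: the category of unitary left $I$-modules (those $M$ with $IM=M$) is equivalent to the category of left $L_K(E_H)$-modules. 2. There is a lattice isomorphism between the lattice of left ideals of $L_K(E)$ contained in $I$ and the lattice of left $L_K(E_H)$-submodules of $\rho I$, where $L_K(E_H)$ acts on $\rho I$ by left multiplication through the canonical homomorphism $L_K(E_H)\to L_K(E)$. 3. Every left ideal of $L_K(E)$ properly containing $I$ is principal; it is generated by an element of the form $p(\tau)=p(0)1_{L_K(E)}+\sum_{i\ge1}a_i\tau^i$, where $p(x)=p(0)+\sum_{i\ge 1}a_ix^i\in K[x]$ has $p(0)=1$. -/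

import Mathlib

open CategoryTheory

universe u v w x

/-- A directed graph `(E⁰, E¹, s, r)`: a type `V` of vertices, a type `Ed` of edges, and the
source and range maps. -/
structure DirectedGraph (V : Type v) (Ed : Type w) where
  s : Ed → V
  r : Ed → V

namespace DirectedGraph

variable {V : Type v} {Ed : Type w}

/-- There is a finite path (possibly of length `0`) from `a` to `b`. -/
def Reaches (E : DirectedGraph V Ed) (a b : V) : Prop :=
  Relation.ReflTransGen (fun p q => ∃ e : Ed, E.s e = p ∧ E.r e = q) a b

/-- A set of vertices is hereditary if it contains every vertex reached by a path that starts
in it. -/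
def Hereditary (E : DirectedGraph V Ed) (H : Set V) : Prop :=
  ∀ a b : V, a ∈ H → E.Reaches a b → b ∈ H

/-- A source loop is a cycle `τ` of length one (`s(τ) = r(τ)`) without entrances: every edge whose
range is the base vertex of `τ` is equal to `τ`. -/
def IsSourceLoop (E : DirectedGraph V Ed) (τ : Ed) : Prop :=
  E.s τ = E.r τ ∧ ∀ e : Ed, E.r e = E.s τ → e = τ

theorem Hereditary.range_mem {E : DirectedGraph V Ed} {H : Set V} (hH : E.Hereditary H)
    {e : Ed} (he : E.s e ∈ H) : E.r e ∈ H :=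
  hH _ _ he (Relation.ReflTransGen.single ⟨e, rfl, rfl⟩)

theorem IsSourceLoop.hereditary {E : DirectedGraph V Ed} {τ : Ed} (hτ : E.IsSourceLoop τ) :
    E.Hereditary {E.s τ}ᶜ := by
  intro a b ha hab
  induction hab with
  | refl => exact ha
  | tail _ h ih =>
    obtain ⟨e, rfl, rfl⟩ := h
    intro hr
    have he := hτ.2 e hr
    subst he
    exact ih rfl

/-- The restriction `E_H` of `E` to a hereditary set `H` of vertices: its vertices are the
elements of `H`, its edges are the edges of `E` whose source lies in `H`. -/
def restrict (E : DirectedGraph V Ed) (H : Set V) (hH : E.Hereditary H) :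
    DirectedGraph H {e : Ed // E.s e ∈ H} where
  s e := ⟨E.s e.1, e.2⟩
  r e := ⟨E.r e.1, hH.range_mem e.2⟩

end DirectedGraph

/-- The generating symbols of the Leavitt path algebra: the vertices `v`, the edges `e` and the
ghost edges `e*`. -/
inductive LeavittGen (V : Type v) (Ed : Type w) : Type (max v w)
  | vert (a : V) : LeavittGen V Ed
  | edge (e : Ed) : LeavittGen V Ed
  | ghost (e : Ed) : LeavittGen V Ed

open LeavittGen

/-- A Cuntz-Krieger `E`-family in a (not necessarily unital) ring `A`. For graphs with infinitely
many edges the last relation is imposed, as usual, at the regular vertices, i.e. those that emit a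
nonempty finite set of edges; in a finite graph these are the vertices that are not sinks. -/
structure IsCuntzKriegerFamily {V : Type v} {Ed : Type w} (E : DirectedGraph V Ed)
    {A : Type x} [NonUnitalRing A] (f : LeavittGen V Ed → A) : Prop where
  vert_idem : ∀ a : V, f (vert a) * f (vert a) = f (vert a)
  vert_orth : ∀ a b : V, a ≠ b → f (vert a) * f (vert b) = 0
  source_edge : ∀ e : Ed, f (vert (E.s e)) * f (edge e) = f (edge e)
  edge_range : ∀ e : Ed, f (edge e) * f (vert (E.r e)) = f (edge e)
  range_ghost : ∀ e : Ed, f (vert (E.r e)) * f (ghost e) = f (ghost e)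
  ghost_source : ∀ e : Ed, f (ghost e) * f (vert (E.s e)) = f (ghost e)
  ghost_edge_self : ∀ e : Ed, f (ghost e) * f (edge e) = f (vert (E.r e))
  ghost_edge_ne : ∀ e e' : Ed, e ≠ e' → f (ghost e) * f (edge e') = 0
  regular_vert : ∀ (a : V) (hfin : (E.s ⁻¹' {a}).Finite), (E.s ⁻¹' {a}).Nonempty →
    f (vert a) = ∑ e ∈ hfin.toFinset, f (edge e) * f (ghost e)

noncomputable section

section LeavittPathAlgebra

variable (K : Type u) [Field K] {V : Type v} {Ed : Type w} (E : DirectedGraph V Ed)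

/-- The free associative (non-unital) `K`-algebra on the generating symbols: the semigroup algebra
of the free semigroup of nonempty words. -/
abbrev LeavittFree (V : Type v) (Ed : Type w) : Type (max u v w) :=
  MonoidAlgebra K (FreeSemigroup (LeavittGen V Ed))

/-- A generating symbol as an element of the free algebra. -/
def LeavittFree.gen (g : LeavittGen V Ed) : LeavittFree K V Ed :=
  MonoidAlgebra.single (FreeSemigroup.of g) 1

/-- The defining relations of the Leavitt path algebra. -/
inductive LeavittRel : LeavittFree K V Ed → LeavittFree K V Ed → Prop
  | vert_idem (a : V) : LeavittRel
      (LeavittFree.gen K (vert a) * LeavittFree.gen K (vert a)) (LeavittFree.gen K (vert a))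
  | vert_orth (a b : V) (h : a ≠ b) : LeavittRel
      (LeavittFree.gen K (vert a) * LeavittFree.gen K (vert b)) 0
  | source_edge (e : Ed) : LeavittRel
      (LeavittFree.gen K (vert (E.s e)) * LeavittFree.gen K (edge e)) (LeavittFree.gen K (edge e))
  | edge_range (e : Ed) : LeavittRel
      (LeavittFree.gen K (edge e) * LeavittFree.gen K (vert (E.r e))) (LeavittFree.gen K (edge e))
  | range_ghost (e : Ed) : LeavittRel
      (LeavittFree.gen K (vert (E.r e)) * LeavittFree.gen K (ghost e))
      (LeavittFree.gen K (ghost e))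
  | ghost_source (e : Ed) : LeavittRel
      (LeavittFree.gen K (ghost e) * LeavittFree.gen K (vert (E.s e)))
      (LeavittFree.gen K (ghost e))
  | ghost_edge_self (e : Ed) : LeavittRel
      (LeavittFree.gen K (ghost e) * LeavittFree.gen K (edge e)) (LeavittFree.gen K (vert (E.r e)))
  | ghost_edge_ne (e e' : Ed) (h : e ≠ e') : LeavittRel
      (LeavittFree.gen K (ghost e) * LeavittFree.gen K (edge e')) 0
  | regular_vert (a : V) (hfin : (E.s ⁻¹' {a}).Finite) (hne : (E.s ⁻¹' {a}).Nonempty) : LeavittRel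
      (LeavittFree.gen K (vert a))
      (∑ e ∈ hfin.toFinset, LeavittFree.gen K (edge e) * LeavittFree.gen K (ghost e))

/-- The smallest ring congruence containing all scalar multiples of the defining relations
(i.e. the `K`-algebra congruence generated by the defining relations). -/
def leavittCon : RingCon (LeavittFree K V Ed) :=
  ringConGen fun p q => ∃ (k : K) (p' q' : LeavittFree K V Ed),
    LeavittRel K E p' q' ∧ p = k • p' ∧ q = k • q'

theorem leavittCon_smul (k : K) {p q : LeavittFree K V Ed} (h : leavittCon K E p q) :
    leavittCon K E (k • p) (k • q) := by
  change RingConGen.Rel _ _ _ at h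
  induction h with
  | of p q h =>
    obtain ⟨l, p', q', h, rfl, rfl⟩ := h
    exact RingConGen.Rel.of _ _ ⟨k * l, p', q', h, smul_smul _ _ _, smul_smul _ _ _⟩
  | refl p => exact (leavittCon K E).refl _
  | symm _ ih => exact (leavittCon K E).symm ih
  | trans _ _ ih1 ih2 => exact (leavittCon K E).trans ih1 ih2
  | add _ _ ih1 ih2 =>
    rw [smul_add, smul_add]
    exact (leavittCon K E).add ih1 ih2
  | mul _ h2 ih1 _ =>
    rw [← smul_mul_assoc, ← smul_mul_assoc]
    exact (leavittCon K E).mul ih1 h2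

/-- The Leavitt path algebra `L_K(E)` of an arbitrary graph `E`: the free associative `K`-algebra
on the vertices, edges and ghost edges modulo the defining relations. It is in general not
unital. -/
def LeavittPathAlgebra : Type (max u v w) := (leavittCon K E).Quotient

namespace LeavittPathAlgebra

instance : NonUnitalRing (LeavittPathAlgebra K E) :=
  inferInstanceAs (NonUnitalRing (leavittCon K E).Quotient)

/-- The quotient map from the free algebra. -/
def mk (p : LeavittFree K V Ed) : LeavittPathAlgebra K E := (p : (leavittCon K E).Quotient)

variable {K E} in
theorem mk_surjective (a : LeavittPathAlgebra K E) : ∃ p, mk K E p = a :=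
  Quotient.exists_rep a

theorem mk_add (p q : LeavittFree K V Ed) : mk K E (p + q) = mk K E p + mk K E q := rfl

theorem mk_mul (p q : LeavittFree K V Ed) : mk K E (p * q) = mk K E p * mk K E q := rfl

theorem mk_zero : mk K E 0 = 0 := rfl

instance : SMul K (LeavittPathAlgebra K E) where
  smul k := Quotient.map (fun p : LeavittFree K V Ed => k • p)
    (fun _ _ h => leavittCon_smul K E k h)

theorem mk_smul (k : K) (p : LeavittFree K V Ed) : mk K E (k • p) = k • mk K E p := rfl

instance : Module K (LeavittPathAlgebra K E) :=
  Function.Surjective.module K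
    ({ toFun := mk K E, map_zero' := rfl, map_add' := mk_add K E } :
      LeavittFree K V Ed →+ LeavittPathAlgebra K E)
    mk_surjective (mk_smul K E)

instance : IsScalarTower K (LeavittPathAlgebra K E) (LeavittPathAlgebra K E) where
  smul_assoc k a b := by
    obtain ⟨p, rfl⟩ := mk_surjective a
    obtain ⟨q, rfl⟩ := mk_surjective b
    simp only [smul_eq_mul, ← mk_smul, ← mk_mul, smul_mul_assoc]

instance : SMulCommClass K (LeavittPathAlgebra K E) (LeavittPathAlgebra K E) where
  smul_comm k a b := by
    obtain ⟨p, rfl⟩ := mk_surjective a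
    obtain ⟨q, rfl⟩ := mk_surjective b
    simp only [smul_eq_mul, ← mk_smul, ← mk_mul, mul_smul_comm]

/-- A generating symbol as an element of `L_K(E)`. -/
def gen (g : LeavittGen V Ed) : LeavittPathAlgebra K E := mk K E (LeavittFree.gen K g)

/-- A vertex as an element of `L_K(E)`. -/
def ofVert (a : V) : LeavittPathAlgebra K E := gen K E (vert a)

/-- An edge as an element of `L_K(E)`. -/
def ofEdge (e : Ed) : LeavittPathAlgebra K E := gen K E (edge e)

theorem mk_eq_of_rel {p q : LeavittFree K V Ed} (h : LeavittRel K E p q) :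
    mk K E p = mk K E q :=
  (RingCon.eq _).2 (RingConGen.Rel.of _ _ ⟨1, p, q, h, (one_smul _ _).symm, (one_smul _ _).symm⟩)

theorem mk_sum {ι : Type*} (t : Finset ι) (p : ι → LeavittFree K V Ed) :
    mk K E (∑ i ∈ t, p i) = ∑ i ∈ t, mk K E (p i) :=
  map_sum ({ toFun := mk K E, map_zero' := rfl, map_add' := mk_add K E } :
      LeavittFree K V Ed →+ LeavittPathAlgebra K E) p t

theorem isCuntzKriegerFamily_gen : IsCuntzKriegerFamily E (gen K E) where
  vert_idem a := mk_eq_of_rel K E (.vert_idem a)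
  vert_orth a b h := mk_eq_of_rel K E (.vert_orth a b h)
  source_edge e := mk_eq_of_rel K E (.source_edge e)
  edge_range e := mk_eq_of_rel K E (.edge_range e)
  range_ghost e := mk_eq_of_rel K E (.range_ghost e)
  ghost_source e := mk_eq_of_rel K E (.ghost_source e)
  ghost_edge_self e := mk_eq_of_rel K E (.ghost_edge_self e)
  ghost_edge_ne e e' h := mk_eq_of_rel K E (.ghost_edge_ne e e' h)
  regular_vert a hfin hne := by
    refine (mk_eq_of_rel K E (.regular_vert a hfin hne)).trans ?_
    rw [mk_sum]
    rfl

theorem induction {P : LeavittPathAlgebra K E → Prop} (zero : P 0)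
    (add : ∀ a b, P a → P b → P (a + b)) (smul : ∀ (k : K) a, P a → P (k • a))
    (gen : ∀ g, P (gen K E g)) (gen_mul : ∀ g a, P a → P (LeavittPathAlgebra.gen K E g * a))
    (a : LeavittPathAlgebra K E) : P a := by
  have hword : ∀ m : FreeSemigroup (LeavittGen V Ed), P (mk K E (MonoidAlgebra.single m 1)) := by
    intro m
    induction m using FreeSemigroup.recOnMul with
    | ih1 g => exact gen g
    | ih2 g m _ ih =>
      have h : (MonoidAlgebra.single (FreeSemigroup.of g * m) 1 : LeavittFree K V Ed)
          = LeavittFree.gen K g * MonoidAlgebra.single m 1 := by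
        rw [LeavittFree.gen, MonoidAlgebra.single_mul_single, one_mul]
      rw [h, mk_mul]
      exact gen_mul g _ ih
  obtain ⟨p, rfl⟩ := mk_surjective a
  induction p using MonoidAlgebra.induction_linear with
  | zero => exact zero
  | add p q hp hq => exact add _ _ hp hq
  | single m k =>
    have h : (MonoidAlgebra.single m k : LeavittFree K V Ed)
        = k • MonoidAlgebra.single m 1 := by
      rw [MonoidAlgebra.smul_single, smul_eq_mul, mul_one]
    rw [h, mk_smul]
    exact smul _ _ (hword m)

section lift

variable {A : Type x} [NonUnitalRing A] [Module K A] [IsScalarTower K A A] [SMulCommClass K A A]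

/-- The homomorphism from the free algebra determined by the images of the generators. -/
def freeLift (f : LeavittGen V Ed → A) : LeavittFree K V Ed →ₙₐ[K] A :=
  MonoidAlgebra.liftMagma K (FreeSemigroup.lift f)

theorem freeLift_gen (f : LeavittGen V Ed → A) (g : LeavittGen V Ed) :
    freeLift K f (LeavittFree.gen K g) = f g := by
  simp [freeLift, LeavittFree.gen]

variable {E}

theorem freeLift_eq {f : LeavittGen V Ed → A} (hf : IsCuntzKriegerFamily E f)
    {p q : LeavittFree K V Ed} (h : leavittCon K E p q) : freeLift K f p = freeLift K f q := by
  change RingConGen.Rel _ _ _ at h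
  induction h with
  | of p q h =>
    obtain ⟨k, p', q', h, rfl, rfl⟩ := h
    rw [map_smul, map_smul]
    congr 1
    cases h with
    | vert_idem a => simpa [freeLift_gen] using hf.vert_idem a
    | vert_orth a b h => simpa [freeLift_gen] using hf.vert_orth a b h
    | source_edge e => simpa [freeLift_gen] using hf.source_edge e
    | edge_range e => simpa [freeLift_gen] using hf.edge_range e
    | range_ghost e => simpa [freeLift_gen] using hf.range_ghost e
    | ghost_source e => simpa [freeLift_gen] using hf.ghost_source e
    | ghost_edge_self e => simpa [freeLift_gen] using hf.ghost_edge_self e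
    | ghost_edge_ne e e' h => simpa [freeLift_gen] using hf.ghost_edge_ne e e' h
    | regular_vert a hfin hne =>
      simpa [freeLift_gen, map_sum] using hf.regular_vert a hfin hne
  | refl p => rfl
  | symm _ ih => exact ih.symm
  | trans _ _ ih1 ih2 => exact ih1.trans ih2
  | add _ _ ih1 ih2 => rw [map_add, map_add, ih1, ih2]
  | mul _ _ ih1 ih2 => rw [map_mul, map_mul, ih1, ih2]

/-- The homomorphism `L_K(E) → A` determined by a Cuntz-Krieger `E`-family in `A`. -/
def lift (f : LeavittGen V Ed → A) (hf : IsCuntzKriegerFamily E f) :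
    LeavittPathAlgebra K E →ₙₐ[K] A where
  toFun := Quotient.lift (freeLift K f) (fun _ _ h => freeLift_eq K hf h)
  map_smul' k a := by
    obtain ⟨p, rfl⟩ := mk_surjective a
    exact map_smul (freeLift K f) k p
  map_zero' := map_zero (freeLift K f)
  map_add' a b := by
    obtain ⟨p, rfl⟩ := mk_surjective a
    obtain ⟨q, rfl⟩ := mk_surjective b
    exact map_add (freeLift K f) p q
  map_mul' a b := by
    obtain ⟨p, rfl⟩ := mk_surjective a
    obtain ⟨q, rfl⟩ := mk_surjective b
    exact map_mul (freeLift K f) p q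

theorem lift_gen (f : LeavittGen V Ed → A) (hf : IsCuntzKriegerFamily E f) (g : LeavittGen V Ed) :
    lift K f hf (gen K E g) = f g :=
  freeLift_gen K f g

end lift

theorem exists_ofVert_mul_gen (g : LeavittGen V Ed) :
    ∃ a, ofVert K E a * gen K E g = gen K E g := by
  cases g with
  | vert a => exact ⟨a, (isCuntzKriegerFamily_gen K E).vert_idem a⟩
  | edge e => exact ⟨E.s e, (isCuntzKriegerFamily_gen K E).source_edge e⟩
  | ghost e => exact ⟨E.r e, (isCuntzKriegerFamily_gen K E).range_ghost e⟩

theorem exists_gen_mul_ofVert (g : LeavittGen V Ed) :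
    ∃ a, gen K E g * ofVert K E a = gen K E g := by
  cases g with
  | vert a => exact ⟨a, (isCuntzKriegerFamily_gen K E).vert_idem a⟩
  | edge e => exact ⟨E.r e, (isCuntzKriegerFamily_gen K E).edge_range e⟩
  | ghost e => exact ⟨E.s e, (isCuntzKriegerFamily_gen K E).ghost_source e⟩

section FiniteVertices

variable [Finite V]

/-- The sum of the vertices in `H`, as an element of `L_K(E)`. -/
def vertexSum (H : Set V) : LeavittPathAlgebra K E := ∑ a ∈ H.toFinite.toFinset, ofVert K E a

theorem vertexSum_mul_ofVert (H : Set V) {a : V} (ha : a ∈ H) :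
    vertexSum K E H * ofVert K E a = ofVert K E a := by
  rw [vertexSum, Finset.sum_mul, Finset.sum_eq_single a]
  · exact (isCuntzKriegerFamily_gen K E).vert_idem a
  · intro b _ hb
    exact (isCuntzKriegerFamily_gen K E).vert_orth b a hb
  · intro h
    exact absurd (H.toFinite.mem_toFinset.2 ha) h

theorem ofVert_mul_vertexSum (H : Set V) {a : V} (ha : a ∈ H) :
    ofVert K E a * vertexSum K E H = ofVert K E a := by
  rw [vertexSum, Finset.mul_sum, Finset.sum_eq_single a]
  · exact (isCuntzKriegerFamily_gen K E).vert_idem a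
  · intro b _ hb
    exact (isCuntzKriegerFamily_gen K E).vert_orth a b hb.symm
  · intro h
    exact absurd (H.toFinite.mem_toFinset.2 ha) h

theorem vertexSum_mul_self (H : Set V) :
    vertexSum K E H * vertexSum K E H = vertexSum K E H := by
  conv_lhs => enter [2]; rw [vertexSum]
  rw [Finset.mul_sum]
  conv_rhs => rw [vertexSum]
  exact Finset.sum_congr rfl fun a ha =>
    vertexSum_mul_ofVert K E H (H.toFinite.mem_toFinset.1 ha)

theorem vertexSum_univ_mul_gen (g : LeavittGen V Ed) :
    vertexSum K E Set.univ * gen K E g = gen K E g := by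
  obtain ⟨a, ha⟩ := exists_ofVert_mul_gen K E g
  rw [← ha, ← mul_assoc, vertexSum_mul_ofVert K E _ (Set.mem_univ a)]

theorem gen_mul_vertexSum_univ (g : LeavittGen V Ed) :
    gen K E g * vertexSum K E Set.univ = gen K E g := by
  obtain ⟨a, ha⟩ := exists_gen_mul_ofVert K E g
  rw [← ha, mul_assoc, ofVert_mul_vertexSum K E _ (Set.mem_univ a)]

/-- If `E` has finitely many vertices, then `L_K(E)` is unital; its identity is the sum of all
vertices. -/
instance : Ring (LeavittPathAlgebra K E) where
  __ := (inferInstance : NonUnitalRing (LeavittPathAlgebra K E))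
  one := vertexSum K E Set.univ
  one_mul a := by
    change vertexSum K E Set.univ * a = a
    induction a using LeavittPathAlgebra.induction with
    | zero => exact mul_zero _
    | add a b ha hb => rw [mul_add, ha, hb]
    | smul k a ha => rw [mul_smul_comm, ha]
    | gen g => exact vertexSum_univ_mul_gen K E g
    | gen_mul g a _ => rw [← mul_assoc, vertexSum_univ_mul_gen]
  mul_one a := by
    change a * vertexSum K E Set.univ = a
    induction a using LeavittPathAlgebra.induction with
    | zero => exact zero_mul _
    | add a b ha hb => rw [add_mul, ha, hb]
    | smul k a ha => rw [smul_mul_assoc, ha]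
    | gen g => exact gen_mul_vertexSum_univ K E g
    | gen_mul g a ha => rw [mul_assoc, ha]

theorem one_def : (1 : LeavittPathAlgebra K E) = vertexSum K E Set.univ := rfl

instance : Algebra K (LeavittPathAlgebra K E) :=
  Algebra.ofModule smul_mul_assoc mul_smul_comm

/-- The two-sided ideal of `L_K(E)` generated by the sum of the vertices in `H`. -/
def vertexIdeal (H : Set V) : TwoSidedIdeal (LeavittPathAlgebra K E) :=
  TwoSidedIdeal.span {vertexSum K E H}

/-- The two-sided ideal generated by the sum of the vertices in `H`, as a (not necessarily unital)
`K`-algebra. -/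
def vertexIdealAlgebra (H : Set V) : NonUnitalSubalgebra K (LeavittPathAlgebra K E) where
  carrier := vertexIdeal K E H
  add_mem' ha hb := (vertexIdeal K E H).add_mem ha hb
  zero_mem' := (vertexIdeal K E H).zero_mem
  mul_mem' {a b} _ hb := (vertexIdeal K E H).mul_mem_left a b hb
  smul_mem' k a ha := by
    rw [Algebra.smul_def]
    exact (vertexIdeal K E H).mul_mem_left _ a ha

end FiniteVertices

section Restrict

variable {K E}
variable {H : Set V} (hH : E.Hereditary H)

/-- The inclusion of the generating symbols of `E_H` into those of `E`. -/
def restrictGen : LeavittGen H {e : Ed // E.s e ∈ H} → LeavittGen V Ed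
  | vert a => vert a.1
  | edge e => edge e.1
  | ghost e => ghost e.1

variable (K) in
theorem isCuntzKriegerFamily_restrict :
    IsCuntzKriegerFamily (E.restrict H hH) (fun g => gen K E (restrictGen g)) where
  vert_idem a := (isCuntzKriegerFamily_gen K E).vert_idem a.1
  vert_orth a b h := (isCuntzKriegerFamily_gen K E).vert_orth a.1 b.1 (fun h' => h (Subtype.ext h'))
  source_edge e := (isCuntzKriegerFamily_gen K E).source_edge e.1
  edge_range e := (isCuntzKriegerFamily_gen K E).edge_range e.1
  range_ghost e := (isCuntzKriegerFamily_gen K E).range_ghost e.1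
  ghost_source e := (isCuntzKriegerFamily_gen K E).ghost_source e.1
  ghost_edge_self e := (isCuntzKriegerFamily_gen K E).ghost_edge_self e.1
  ghost_edge_ne e e' h :=
    (isCuntzKriegerFamily_gen K E).ghost_edge_ne e.1 e'.1 (fun h' => h (Subtype.ext h'))
  regular_vert a hfin hne := by
    have himg : E.s ⁻¹' {a.1} = Subtype.val '' ((E.restrict H hH).s ⁻¹' {a}) := by
      ext e
      constructor
      · intro he
        have he' : E.s e = a.1 := he
        exact ⟨⟨e, he' ▸ a.2⟩, Subtype.ext he', rfl⟩
      · rintro ⟨e', he', rfl⟩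
        exact congrArg Subtype.val (show (E.restrict H hH).s e' = a from he')
    have hfin' : (E.s ⁻¹' {a.1}).Finite := himg ▸ hfin.image _
    refine ((isCuntzKriegerFamily_gen K E).regular_vert a.1 hfin' (himg ▸ hne.image _)).trans ?_
    symm
    refine Finset.sum_bij (fun e _ => e.1) ?_ ?_ ?_ ?_
    · intro e he
      rw [Set.Finite.mem_toFinset] at he ⊢
      rw [himg]
      exact ⟨e, he, rfl⟩
    · intro e _ e' _ h
      exact Subtype.ext h
    · intro e he
      rw [Set.Finite.mem_toFinset, himg] at he
      obtain ⟨e', he', rfl⟩ := he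
      exact ⟨e', hfin.mem_toFinset.2 he', rfl⟩
    · intro e _
      rfl

variable (K) in
/-- The canonical homomorphism `L_K(E_H) → L_K(E)`, which sends every vertex, edge and ghost edge
of `E_H` to itself. -/
def restrictHom : LeavittPathAlgebra K (E.restrict H hH) →ₙₐ[K] LeavittPathAlgebra K E :=
  lift K (fun g => gen K E (restrictGen g)) (isCuntzKriegerFamily_restrict K hH)

variable [Finite V]

theorem restrictHom_one : restrictHom K hH 1 = vertexSum K E H := by
  rw [one_def, vertexSum, vertexSum, map_sum]
  refine Finset.sum_bij (fun a _ => a.1) ?_ ?_ ?_ ?_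
  · intro a _
    exact H.toFinite.mem_toFinset.2 a.2
  · intro a _ b _ h
    exact Subtype.ext h
  · intro a ha
    exact ⟨⟨a, H.toFinite.mem_toFinset.1 ha⟩, by simp, rfl⟩
  · intro a _
    exact lift_gen K _ _ _

variable (K E) in
/-- The subgroup `ρI = {ρ y : y ∈ I}` of `L_K(E)`, where `ρ` is the sum of the vertices in `H` and
`I` is the two-sided ideal generated by `ρ`. -/
def vertexSumIdeal (H : Set V) : AddSubgroup (LeavittPathAlgebra K E) where
  carrier := {z | ∃ y ∈ vertexIdeal K E H, z = vertexSum K E H * y}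
  add_mem' := by
    rintro _ _ ⟨y, hy, rfl⟩ ⟨y', hy', rfl⟩
    exact ⟨y + y', (vertexIdeal K E H).add_mem hy hy', (mul_add _ _ _).symm⟩
  zero_mem' := ⟨0, (vertexIdeal K E H).zero_mem, (mul_zero _).symm⟩
  neg_mem' := by
    rintro _ ⟨y, hy, rfl⟩
    exact ⟨-y, (vertexIdeal K E H).neg_mem hy, (mul_neg _ _).symm⟩

theorem restrictHom_mul_mem (a : LeavittPathAlgebra K (E.restrict H hH))
    {z : LeavittPathAlgebra K E} (hz : z ∈ vertexSumIdeal K E H) :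
    restrictHom K hH a * z ∈ vertexSumIdeal K E H := by
  obtain ⟨y, hy, rfl⟩ := hz
  refine ⟨restrictHom K hH a * (vertexSum K E H * y), ?_, ?_⟩
  · exact (vertexIdeal K E H).mul_mem_left _ _ ((vertexIdeal K E H).mul_mem_left _ _ hy)
  · rw [← mul_assoc (vertexSum K E H) (restrictHom K hH a), ← restrictHom_one hH, ← map_mul,
      one_mul]

/-- `ρI` as a left `L_K(E_H)`-module: `L_K(E_H)` acts by left multiplication in `L_K(E)`, through
the canonical homomorphism `L_K(E_H) → L_K(E)`. -/
instance : Module (LeavittPathAlgebra K (E.restrict H hH)) (vertexSumIdeal K E H) where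
  smul a z := ⟨restrictHom K hH a * z.1, restrictHom_mul_mem hH a z.2⟩
  one_smul z := by
    obtain ⟨_, y, hy, rfl⟩ := z
    refine Subtype.ext ?_
    change restrictHom K hH 1 * (vertexSum K E H * y) = vertexSum K E H * y
    rw [restrictHom_one, ← mul_assoc, vertexSum_mul_self]
  mul_smul a b z := Subtype.ext (by
    change restrictHom K hH (a * b) * z.1 = restrictHom K hH a * (restrictHom K hH b * z.1)
    rw [map_mul, mul_assoc])
  smul_zero a := Subtype.ext (mul_zero _)
  smul_add a z z' := Subtype.ext (mul_add _ _ _)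
  add_smul a b z := Subtype.ext (by
    change restrictHom K hH (a + b) * z.1 = restrictHom K hH a * z.1 + restrictHom K hH b * z.1
    rw [map_add, add_mul])
  zero_smul z := Subtype.ext (by
    change restrictHom K hH 0 * z.1 = 0
    rw [map_zero, zero_mul])

end Restrict

end LeavittPathAlgebra

end LeavittPathAlgebra

/-- A unitary left module over a not necessarily unital ring `A`: an abelian group `M` with a
biadditive associative action of `A` such that `A M = M`. -/
structure UnitaryModuleCat (A : Type u) [NonUnitalRing A] where
  carrier : Type w
  [addCommGroup : AddCommGroup carrier]
  act : A →ₙ+* AddMonoid.End carrier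
  unitary : AddSubgroup.closure {m : carrier | ∃ (a : A) (n : carrier), m = act a n} = ⊤

namespace UnitaryModuleCat

attribute [instance] UnitaryModuleCat.addCommGroup

variable {A : Type u} [NonUnitalRing A]

/-- Homomorphisms of unitary left `A`-modules. -/
@[ext]
structure Hom (M N : UnitaryModuleCat.{u, w} A) where
  toAddMonoidHom : M.carrier →+ N.carrier
  map_act : ∀ (a : A) (m : M.carrier), toAddMonoidHom (M.act a m) = N.act a (toAddMonoidHom m)

/-- The category of unitary left `A`-modules. -/
instance : Category.{w} (UnitaryModuleCat.{u, w} A) where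
  Hom M N := Hom M N
  id M := ⟨AddMonoidHom.id _, fun _ _ => rfl⟩
  comp f g := ⟨g.toAddMonoidHom.comp f.toAddMonoidHom, fun a m => by
    rw [AddMonoidHom.comp_apply, AddMonoidHom.comp_apply, f.map_act, g.map_act]⟩

end UnitaryModuleCat

end

/-
The products `p a q*`, in which `p` and `q` are paths that first enter `H` at their end and `a`
comes from `L_K(E_H)`, span the ideal `I`, as in a matrix ring. Hence attaching to `E_H` one new
vertex and one new edge for every such path of positive length gives a hedgehog graph whose
Leavitt path algebra maps isomorphically onto `I`. This presentation shows that `I` has local units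
and that `L_K(E_H)` is the full corner `ρIρ` of `I`, which yields the Morita equivalence `M ↦ ρM`
and the lattice isomorphism `J ↦ J ∩ ρI`.

For a source loop `τ`, every element of `I` is killed on the right by a power of `τ`, because
`ρτ = 0` and this property passes to products. Hence `I ⊆ L_K(E) p(τ)` as soon as `p(0) = 1`, for
`p` is then coprime to every power of `x`. Modulo `I` the loop becomes invertible and generates,
with its inverse, the whole quotient, so a left ideal above `I` is determined by the polynomials `p`
with `p(τ)` in it, and these form an ideal of `K[x]` that is stable under division by `x`.
-/

/-- Every finite subset of `B` has a common left unit in `B`; this replaces the identity of `B` in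
arguments about unitary modules and left ideals. -/
def HasLeftLocalUnits (B : Type*) [NonUnitalRing B] : Prop :=
  ∀ s : Finset B, ∃ u : B, ∀ b ∈ s, u * b = b

theorem HasLeftLocalUnits.exists_mul_eq_self {B : Type*} [NonUnitalRing B]
    (hB : HasLeftLocalUnits B) (b : B) : ∃ u, u * b = b :=
  (hB {b}).imp fun _ hu => hu b (Finset.mem_singleton_self b)

theorem HasLeftLocalUnits.of_bijective {B C F : Type*} [NonUnitalRing B] [NonUnitalRing C]
    [FunLike F B C] [MulHomClass F B C] (hB : HasLeftLocalUnits B) {f : F}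
    (hf : Function.Bijective f) : HasLeftLocalUnits C := by
  intro s
  obtain ⟨u, hu⟩ := hB (s.preimage f hf.injective.injOn)
  refine ⟨f u, fun c hc => ?_⟩
  obtain ⟨b, rfl⟩ := hf.surjective c
  rw [← map_mul, hu b (Finset.mem_preimage.2 hc)]

/-- The homomorphism `φ` identifies the unital ring `R` with the corner `e B e` of a full
idempotent `e = φ 1`, i.e. one with `B e B = B`. -/
structure IsFullCorner {R B : Type*} [Ring R] [NonUnitalRing B] (φ : R →ₙ+* B) : Prop where
  injective : Function.Injective φ
  corner_mem_range : ∀ b, φ 1 * b * φ 1 ∈ Set.range φ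
  closure_eq_top : AddSubgroup.closure {z | ∃ a c, z = a * φ 1 * c} = ⊤

namespace IsFullCorner

variable {R B : Type*} [Ring R] [NonUnitalRing B] {φ : R →ₙ+* B}

theorem map_one_mul_map (φ : R →ₙ+* B) (a : R) : φ 1 * φ a = φ a := by
  rw [← map_mul, one_mul]

theorem map_mul_map_one (φ : R →ₙ+* B) (a : R) : φ a * φ 1 = φ a := by
  rw [← map_mul, mul_one]

theorem addMonoidHom_ext (h : IsFullCorner φ) {X : Type*} [AddCommGroup X] {f g : B →+ X}
    (hfg : ∀ a c, f (a * φ 1 * c) = g (a * φ 1 * c)) : f = g :=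
  AddMonoidHom.eq_of_eqOn_dense h.closure_eq_top <| by
    rintro _ ⟨a, c, rfl⟩
    exact hfg a c

theorem comp_of_bijective (h : IsFullCorner φ) {C : Type*} [NonUnitalRing C] {ψ : B →ₙ+* C}
    (hψ : Function.Bijective ψ) : IsFullCorner (ψ.comp φ) where
  injective := hψ.injective.comp h.injective
  corner_mem_range c := by
    obtain ⟨b, rfl⟩ := hψ.surjective c
    obtain ⟨a, ha⟩ := h.corner_mem_range b
    exact ⟨a, by simp [ha]⟩
  closure_eq_top := by
    refine (AddSubgroup.eq_top_iff' _).2 fun c => ?_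
    obtain ⟨b, rfl⟩ := hψ.surjective c
    have hb : ψ b ∈ (AddSubgroup.closure {z | ∃ a c, z = a * φ 1 * c}).map ψ.toAddMonoidHom :=
      ⟨b, h.closure_eq_top ▸ AddSubgroup.mem_top b, rfl⟩
    rw [AddMonoidHom.map_closure] at hb
    refine AddSubgroup.closure_mono ?_ hb
    rintro _ ⟨_, ⟨a, c, rfl⟩, rfl⟩
    exact ⟨ψ a, ψ c, by simp⟩

theorem injective_of_injective_comp (h : IsFullCorner φ) (hl : HasLeftLocalUnits B)
    (hr : ∀ b : B, ∃ u, b * u = b) {B' : Type*} [NonUnitalRing B'] {ψ : B →ₙ+* B'}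
    (hψ : Function.Injective (ψ.comp φ)) : Function.Injective ψ := by
  rw [injective_iff_map_eq_zero]
  intro b hb
  have corner_zero (c d : B) : φ 1 * (c * b * d) * φ 1 = 0 := by
    obtain ⟨a, ha⟩ := h.corner_mem_range (c * b * d)
    have ha0 : a = 0 := hψ (by simp [ha, hb])
    rw [← ha, ha0, map_zero]
  have right_zero (c y : B) : φ 1 * (c * b * y) = 0 := by
    refine DFunLike.congr_fun (h.addMonoidHom_ext
      (f := (AddMonoidHom.mulLeft (φ 1)).comp (AddMonoidHom.mulLeft (c * b))) (g := 0)
      fun a d => ?_) y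
    simpa [mul_assoc] using congrArg (· * d) (corner_zero c a)
  have left_zero (x y : B) : x * (b * y) = 0 := by
    refine DFunLike.congr_fun (h.addMonoidHom_ext
      (f := AddMonoidHom.mulRight (b * y)) (g := 0) fun a c => ?_) x
    simpa [mul_assoc] using congrArg (a * ·) (right_zero c y)
  obtain ⟨u, hu⟩ := hl.exists_mul_eq_self b
  obtain ⟨v, hv⟩ := hr b
  rw [← hu, ← hv, left_zero]

/-- The additive map `b ↦ φ⁻¹(φ 1 * b * φ 1)`. -/
noncomputable def compress (h : IsFullCorner φ) : B →+ R :=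
  AddMonoidHom.mk' (fun b => (h.corner_mem_range b).choose) fun a b => h.injective <| by
    rw [map_add, (h.corner_mem_range a).choose_spec, (h.corner_mem_range b).choose_spec,
      (h.corner_mem_range (a + b)).choose_spec, mul_add, add_mul]

theorem map_compress (h : IsFullCorner φ) (b : B) : φ (h.compress b) = φ 1 * b * φ 1 :=
  (h.corner_mem_range b).choose_spec

theorem compress_map (h : IsFullCorner φ) (a : R) : h.compress (φ a) = a :=
  h.injective <| by rw [map_compress, map_one_mul_map, map_mul_map_one]

theorem compress_map_mul (h : IsFullCorner φ) (a : R) (b : B) :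
    h.compress (φ a * b) = a * h.compress b :=
  h.injective <| by
    rw [map_compress, map_mul, map_compress, ← mul_assoc, ← mul_assoc, ← mul_assoc,
      map_one_mul_map, map_mul_map_one]

theorem compress_mul_map_one (h : IsFullCorner φ) (b : B) :
    h.compress (b * φ 1) = h.compress b :=
  h.injective <| by
    simp only [map_compress, mul_assoc, map_one_mul_map]

end IsFullCorner

namespace UnitaryModuleCat

variable {R : Type u} {B : Type v} [Ring R] [NonUnitalRing B]

theorem act_mul (M : UnitaryModuleCat.{v, w} B) (a b : B) (m : M.carrier) :
    M.act (a * b) m = M.act a (M.act b m) := by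
  rw [map_mul]; rfl

/-- The action of `B` on a fixed element of a module, as an additive map. -/
def actOn (M : UnitaryModuleCat.{v, w} B) (m : M.carrier) : B →+ M.carrier :=
  (AddMonoidHom.eval m).comp M.act.toAddMonoidHom

theorem actOn_apply (M : UnitaryModuleCat.{v, w} B) (m : M.carrier) (b : B) :
    M.actOn m b = M.act b m := rfl

theorem act_add (M : UnitaryModuleCat.{v, w} B) (a b : B) (m : M.carrier) :
    M.act (a + b) m = M.act a m + M.act b m :=
  (M.actOn m).map_add a b

theorem act_neg (M : UnitaryModuleCat.{v, w} B) (a : B) (m : M.carrier) :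
    M.act (-a) m = -M.act a m :=
  (M.actOn m).map_neg a

/-- The corner `φ(1) M` of a unitary module. -/
def corner (φ : R →ₙ+* B) (M : UnitaryModuleCat.{v, w} B) : AddSubgroup M.carrier where
  carrier := {m | M.act (φ 1) m = m}
  zero_mem' := map_zero _
  add_mem' ha hb := (map_add _ _ _).trans (congrArg₂ _ ha hb)
  neg_mem' ha := (map_neg _ _).trans (congrArg _ ha)

section Corner

variable {φ : R →ₙ+* B} {M N : UnitaryModuleCat.{v, w} B}

theorem act_map_one_of_mem_corner {m : M.carrier} (hm : m ∈ corner φ M) : M.act (φ 1) m = m := hm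

/-- The additive map `M → φ(1) M`, `m ↦ φ(1) b m`. -/
def toCorner (φ : R →ₙ+* B) (M : UnitaryModuleCat.{v, w} B) (b : B) : M.carrier →+ corner φ M :=
  AddMonoidHom.codRestrict (M.act (φ 1 * b)) (corner φ M) fun m => by
    change M.act (φ 1) (M.act (φ 1 * b) m) = M.act (φ 1 * b) m
    rw [← act_mul, ← mul_assoc, IsFullCorner.map_one_mul_map]

theorem coe_toCorner (b : B) (m : M.carrier) :
    (toCorner φ M b m : M.carrier) = M.act (φ 1 * b) m := rfl

theorem toCorner_act (a b : B) (m : M.carrier) :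
    toCorner φ M a (M.act b m) = toCorner φ M (a * b) m :=
  Subtype.ext <| by rw [coe_toCorner, coe_toCorner, ← act_mul, mul_assoc]

instance (φ : R →ₙ+* B) (M : UnitaryModuleCat.{v, w} B) : Module R (corner φ M) where
  smul a m := toCorner φ M (φ a) m
  one_smul m := Subtype.ext <| by
    change M.act (φ 1 * φ 1) m = m
    rw [IsFullCorner.map_one_mul_map, act_map_one_of_mem_corner m.2]
  mul_smul a b m := by
    change toCorner φ M (φ (a * b)) m = toCorner φ M (φ a) (toCorner φ M (φ b) m)
    rw [coe_toCorner, toCorner_act, IsFullCorner.map_one_mul_map, map_mul]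
  smul_zero a := map_zero (toCorner φ M (φ a))
  smul_add a m n := map_add (toCorner φ M (φ a)) _ _
  add_smul a b m := Subtype.ext <|
    ((M.actOn m.1).comp ((AddMonoidHom.mulLeft (φ 1)).comp φ.toAddMonoidHom)).map_add a b
  zero_smul m := Subtype.ext <|
    ((M.actOn m.1).comp ((AddMonoidHom.mulLeft (φ 1)).comp φ.toAddMonoidHom)).map_zero

theorem coe_smul_corner (a : R) (m : corner φ M) :
    ((a • m : corner φ M) : M.carrier) = M.act (φ a) m :=
  congrArg (M.act · m.1) (IsFullCorner.map_one_mul_map φ a)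

theorem map_toCorner (hφ : IsFullCorner φ) (g : corner φ M →ₗ[R] corner φ N) (b : B)
    (m : corner φ M) : g (toCorner φ M b m) = toCorner φ N b (g m) := by
  obtain ⟨a, ha⟩ := hφ.corner_mem_range b
  have toCorner_eq {P : UnitaryModuleCat.{v, w} B} (p : corner φ P) :
      toCorner φ P b p = a • p := Subtype.ext <| by
    rw [coe_smul_corner, ha, act_mul, act_map_one_of_mem_corner p.2, coe_toCorner]
  rw [toCorner_eq, toCorner_eq, map_smul]

end Corner

/-- The functor that sends a unitary `B`-module `M` to the `R`-module `φ(1) M`. -/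
def cornerFunctor (φ : R →ₙ+* B) : UnitaryModuleCat.{v, w} B ⥤ ModuleCat.{w} R where
  obj M := ModuleCat.of R (corner φ M)
  map f := ModuleCat.ofHom
    { toFun m := ⟨f.toAddMonoidHom m.1,
        (f.map_act _ _).symm.trans (congrArg _ (act_map_one_of_mem_corner m.2))⟩
      map_add' _ _ := Subtype.ext (map_add _ _ _)
      map_smul' _ _ := Subtype.ext (f.map_act _ _) }
  map_id _ := rfl
  map_comp _ _ := rfl

theorem exists_act_eq_self (hB : HasLeftLocalUnits B) (M : UnitaryModuleCat.{v, w} B)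
    (m : M.carrier) : ∃ u, M.act u m = m := by
  classical
  have units_of_finset : ∃ s : Finset B, ∀ u, (∀ b ∈ s, u * b = b) → M.act u m = m := by
    have hm : m ∈ (⊤ : AddSubgroup M.carrier) := trivial
    rw [← M.unitary] at hm
    induction hm using AddSubgroup.closure_induction with
    | mem m hm =>
      obtain ⟨b, n, rfl⟩ := hm
      exact ⟨{b}, fun u hu => by rw [← act_mul, hu b (Finset.mem_singleton_self b)]⟩
    | zero => exact ⟨∅, fun u _ => map_zero _⟩
    | add m n _ _ hm hn =>
      obtain ⟨s, hs⟩ := hm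
      obtain ⟨t, ht⟩ := hn
      refine ⟨s ∪ t, fun u hu => ?_⟩
      rw [map_add, hs u fun b hb => hu b (Finset.mem_union_left t hb),
        ht u fun b hb => hu b (Finset.mem_union_right s hb)]
    | neg m _ hm => exact hm.imp fun s hs u hu => by rw [map_neg, hs u hu]
  obtain ⟨s, hs⟩ := units_of_finset
  exact (hB s).imp hs

section FullCorner

variable {φ : R →ₙ+* B} (hφ : IsFullCorner φ) (hB : HasLeftLocalUnits B)
include hφ hB

theorem eq_of_toCorner_eq {M : UnitaryModuleCat.{v, w} B} {m n : M.carrier}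
    (hmn : ∀ c, toCorner φ M c m = toCorner φ M c n) : m = n := by
  have act_eq : M.actOn m = M.actOn n := hφ.addMonoidHom_ext fun a c => by
    rw [mul_assoc, actOn_apply, actOn_apply, act_mul, act_mul M a _ n]
    exact congrArg (M.act a) (congrArg Subtype.val (hmn c))
  obtain ⟨u, hu⟩ := exists_act_eq_self hB M (m - n)
  rw [← sub_eq_zero, ← hu, map_sub, sub_eq_zero]
  exact DFunLike.congr_fun act_eq u

theorem cornerFunctor_faithful : (cornerFunctor.{u, v, w} φ).Faithful where
  map_injective {M N f g} hfg := by
    refine UnitaryModuleCat.Hom.ext (AddMonoidHom.ext fun m =>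
      eq_of_toCorner_eq hφ hB fun c => Subtype.ext ?_)
    rw [coe_toCorner, coe_toCorner, ← f.map_act, ← g.map_act]
    exact congrArg Subtype.val
      (LinearMap.congr_fun (ModuleCat.hom_ext_iff.1 hfg) (toCorner φ M c m))

variable {M N : UnitaryModuleCat.{v, w} B} (g : corner φ M →ₗ[R] corner φ N)

theorem exists_toCorner_eq_map_toCorner (m : M.carrier) :
    ∃ n : N.carrier, ∀ c, toCorner φ N c n = g (toCorner φ M c m) := by
  obtain ⟨u, hu⟩ := exists_act_eq_self hB M m
  rw [← hu]
  have hu_mem : u ∈ (⊤ : AddSubgroup B) := trivial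
  clear hu
  rw [← hφ.closure_eq_top] at hu_mem
  induction hu_mem using AddSubgroup.closure_induction with
  | mem b hb =>
    obtain ⟨a, d, rfl⟩ := hb
    refine ⟨N.act a (g (toCorner φ M d m)), fun c => ?_⟩
    rw [toCorner_act, ← map_toCorner hφ, coe_toCorner, toCorner_act, toCorner_act]
    simp only [mul_assoc]
  | zero => exact ⟨0, fun c => by simp⟩
  | add a b _ _ ha hb =>
    obtain ⟨n, hn⟩ := ha
    obtain ⟨n', hn'⟩ := hb
    exact ⟨n + n', fun c => by rw [act_add, map_add, hn, hn', map_add, map_add]⟩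
  | neg a _ ha =>
    obtain ⟨n, hn⟩ := ha
    exact ⟨-n, fun c => by rw [act_neg, map_neg, hn, map_neg, map_neg]⟩

theorem exists_hom_extending : ∃ f : M ⟶ N, ∀ m : corner φ M, f.toAddMonoidHom m = g m := by
  choose f hf using exists_toCorner_eq_map_toCorner hφ hB g
  refine ⟨⟨AddMonoidHom.mk' f fun m n => ?add, fun b m => ?act⟩, fun m => ?corner⟩
  all_goals refine eq_of_toCorner_eq hφ hB fun c => ?_
  case add => rw [map_add, hf, hf, hf, map_add, map_add]
  case act => exact (hf _ c).trans (by rw [toCorner_act, ← hf, ← toCorner_act]; rfl)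
  case corner => exact (hf m c).trans (map_toCorner hφ g c m)

theorem cornerFunctor_full : (cornerFunctor.{u, v, w} φ).Full where
  map_surjective g := by
    obtain ⟨f, hf⟩ := exists_hom_extending hφ hB g.hom
    exact ⟨f, ModuleCat.hom_ext <| LinearMap.ext fun m => Subtype.ext (hf m)⟩

end FullCorner

section Coinduced

variable (φ : R →ₙ+* B) (N : Type w) [AddCommGroup N] [Module R N]

/-- The left `B`-module `Hom_R(B, N)` of additive maps that are linear along `φ`, on which `B` acts
by right translation `(b p)(y) = p (y b)`. It is not unitary in general. -/
def linearMapsAlong : AddSubgroup (B →+ N) where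
  carrier := {p | ∀ a b, p (φ a * b) = a • p b}
  zero_mem' _ _ := (smul_zero _).symm
  add_mem' hp hq a b := (congrArg₂ _ (hp a b) (hq a b)).trans (smul_add _ _ _).symm
  neg_mem' hp a b := (congrArg _ (hp a b)).trans (smul_neg _ _).symm

/-- The unitary part `B Hom_R(B, N)` of `Hom_R(B, N)`. -/
def coinducedSubgroup : AddSubgroup (B →+ N) :=
  AddSubgroup.closure {q | ∃ b, ∃ p ∈ linearMapsAlong φ N, q = p.comp (AddMonoidHom.mulRight b)}

variable {φ N}

theorem comp_mulRight_mem_linearMapsAlong (b : B) {p : B →+ N} (hp : p ∈ linearMapsAlong φ N) :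
    p.comp (AddMonoidHom.mulRight b) ∈ linearMapsAlong φ N := fun a y => by
  simpa [mul_assoc] using hp a (y * b)

theorem comp_mulRight_mem_coinducedSubgroup (b : B) {p : B →+ N}
    (hp : p ∈ linearMapsAlong φ N) :
    p.comp (AddMonoidHom.mulRight b) ∈ coinducedSubgroup φ N :=
  AddSubgroup.subset_closure ⟨b, p, hp, rfl⟩

theorem coinducedSubgroup_le : coinducedSubgroup φ N ≤ linearMapsAlong φ N := by
  rw [coinducedSubgroup, AddSubgroup.closure_le]
  rintro _ ⟨b, p, hp, rfl⟩
  exact comp_mulRight_mem_linearMapsAlong b hp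

variable (φ N) in
/-- The action of `B` on `B Hom_R(B, N)`. -/
def coinducedAct : B →ₙ+* AddMonoid.End (coinducedSubgroup φ N) where
  toFun b := AddMonoidHom.mk' (fun q => ⟨q.1.comp (AddMonoidHom.mulRight b),
    comp_mulRight_mem_coinducedSubgroup b (coinducedSubgroup_le q.2)⟩) fun _ _ => rfl
  map_mul' a b := by
    ext q y
    exact congrArg q.1 (mul_assoc y a b).symm
  map_zero' := by
    ext q y
    exact (congrArg q.1 (mul_zero y)).trans (map_zero _)
  map_add' a b := by
    ext q y
    exact (congrArg q.1 (mul_add y a b)).trans (map_add _ _ _)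

variable (φ N) in
/-- The unitary `B`-module `B Hom_R(B, N)`. -/
def coinduced (hB : HasLeftLocalUnits B) : UnitaryModuleCat.{v, max v w} B where
  carrier := coinducedSubgroup φ N
  act := coinducedAct φ N
  unitary := by
    rw [eq_top_iff]
    rintro ⟨q, hq⟩ -
    induction hq using AddSubgroup.closure_induction with
    | mem q hq =>
      obtain ⟨b, p, hp, rfl⟩ := hq
      obtain ⟨u, hu⟩ := hB.exists_mul_eq_self b
      refine AddSubgroup.subset_closure
        ⟨u, ⟨_, comp_mulRight_mem_coinducedSubgroup b hp⟩, Subtype.ext ?_⟩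
      ext y
      exact congrArg p (by simp [mul_assoc, hu])
    | zero => exact zero_mem _
    | add p q _ _ ihp ihq => exact add_mem ihp ihq
    | neg p _ ihp => exact neg_mem ihp

theorem nonempty_corner_coinduced_equiv (hφ : IsFullCorner φ) (hB : HasLeftLocalUnits B) :
    Nonempty (corner φ (coinduced φ N hB) ≃ₗ[R] N) := by
  let evalOne : corner φ (coinduced φ N hB) →ₗ[R] N :=
    { toFun q := q.1.1 (φ 1)
      map_add' _ _ := rfl
      map_smul' a q := by
        rw [coe_smul_corner]
        change q.1.1 (φ 1 * φ a) = a • q.1.1 (φ 1)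
        rw [← coinducedSubgroup_le q.1.2, ← map_mul, ← map_mul, one_mul, mul_one] }
  have apply_eq (q : corner φ (coinduced φ N hB)) (y : B) :
      q.1.1 y = hφ.compress y • evalOne q := by
    have hq : q.1.1 (y * φ 1) = q.1.1 y :=
      congrArg (fun p : coinducedSubgroup φ N => p.1 y) (act_map_one_of_mem_corner q.2)
    change q.1.1 y = hφ.compress y • q.1.1 (φ 1)
    rw [← coinducedSubgroup_le q.1.2, hφ.map_compress, mul_assoc, mul_assoc,
      IsFullCorner.map_one_mul_map, coinducedSubgroup_le q.1.2, one_smul, hq]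
  refine ⟨LinearEquiv.ofBijective evalOne
    ⟨(injective_iff_map_eq_zero _).2 fun q hq => ?_, fun n => ?_⟩⟩
  · refine Subtype.ext (Subtype.ext (AddMonoidHom.ext fun y => ?_))
    rw [apply_eq, hq, smul_zero]
    rfl
  · let p : B →+ N := ((AddMonoidHom.flip (smulAddHom R N)) n).comp hφ.compress
    have hp : p ∈ linearMapsAlong φ N := fun a b => by
      simp [p, hφ.compress_map_mul, mul_smul]
    have p_fixed : p.comp (AddMonoidHom.mulRight (φ 1)) = p := AddMonoidHom.ext fun y => by
      simp [p, hφ.compress_mul_map_one]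
    refine ⟨⟨⟨p, p_fixed ▸ comp_mulRight_mem_coinducedSubgroup (φ 1) hp⟩,
      Subtype.ext p_fixed⟩, ?_⟩
    change hφ.compress (φ 1) • n = n
    rw [hφ.compress_map, one_smul]

end Coinduced

theorem cornerFunctor_essSurj {φ : R →ₙ+* B} (hφ : IsFullCorner φ) (hB : HasLeftLocalUnits B) :
    (cornerFunctor.{u, v, max v w} φ).EssSurj where
  mem_essImage N := by
    obtain ⟨equiv⟩ := nonempty_corner_coinduced_equiv (N := N) hφ hB
    exact ⟨coinduced φ N hB, ⟨equiv.toModuleIso⟩⟩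

theorem nonempty_equivalence_of_isFullCorner {φ : R →ₙ+* B} (hφ : IsFullCorner φ)
    (hB : HasLeftLocalUnits B) :
    Nonempty (UnitaryModuleCat.{v, max v w} B ≌ ModuleCat.{max v w} R) := by
  have := cornerFunctor_faithful.{u, v, max v w} hφ hB
  have := cornerFunctor_full.{u, v, max v w} hφ hB
  have := cornerFunctor_essSurj.{u, v, w} hφ hB
  have : (cornerFunctor.{u, v, max v w} φ).IsEquivalence := {}
  exact ⟨(cornerFunctor φ).asEquivalence⟩

end UnitaryModuleCat

noncomputable section

theorem IsCuntzKriegerFamily.map {V : Type v} {Ed : Type w} {E : DirectedGraph V Ed}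
    {A B F : Type*} [NonUnitalRing A] [NonUnitalRing B] [FunLike F A B]
    [NonUnitalRingHomClass F A B]
    {f : LeavittGen V Ed → A} (hf : IsCuntzKriegerFamily E f) (φ : F) :
    IsCuntzKriegerFamily E fun g => φ (f g) where
  vert_idem a := by rw [← map_mul, hf.vert_idem]
  vert_orth a b h := by rw [← map_mul, hf.vert_orth a b h, map_zero]
  source_edge e := by rw [← map_mul, hf.source_edge]
  edge_range e := by rw [← map_mul, hf.edge_range]
  range_ghost e := by rw [← map_mul, hf.range_ghost]
  ghost_source e := by rw [← map_mul, hf.ghost_source]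
  ghost_edge_self e := by rw [← map_mul, hf.ghost_edge_self]
  ghost_edge_ne e d h := by rw [← map_mul, hf.ghost_edge_ne e d h, map_zero]
  regular_vert a hfin hne := by simp only [hf.regular_vert a hfin hne, map_sum, map_mul]

namespace LeavittGen

variable {V W : Type*} {Ed D : Type*}

/-- The involution that fixes the vertices and exchanges every edge with its ghost. -/
def adjoint : LeavittGen V Ed → LeavittGen V Ed
  | vert a => vert a
  | edge e => ghost e
  | ghost e => edge e

theorem adjoint_adjoint (g : LeavittGen V Ed) : g.adjoint.adjoint = g := by
  cases g <;> rfl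

/-- The map of generating symbols induced by a map of vertices and a map of edges. -/
def map (f : W → V) (g : D → Ed) : LeavittGen W D → LeavittGen V Ed
  | vert a => vert (f a)
  | edge e => edge (g e)
  | ghost e => ghost (g e)

theorem map_injective {f : W → V} {g : D → Ed} (hf : Function.Injective f)
    (hg : Function.Injective g) : Function.Injective (map f g) := by
  rintro (a | e | e) (b | d | d) h <;> simp only [map, reduceCtorEq] at h
  · exact congrArg vert (hf (vert.inj h))
  · exact congrArg edge (hg (edge.inj h))
  · exact congrArg ghost (hg (ghost.inj h))

theorem adjoint_map (f : W → V) (g : D → Ed) (x : LeavittGen W D) :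
    (x.map f g).adjoint = x.adjoint.map f g := by
  cases x <;> rfl

end LeavittGen

namespace LeavittPathAlgebra

variable {K : Type u} [Field K] {V : Type v} {Ed : Type w} {E : DirectedGraph V Ed}

theorem hom_ext {A : Type*} [NonUnitalRing A] [Module K A] {f g : LeavittPathAlgebra K E →ₙₐ[K] A}
    (h : ∀ x, f (gen K E x) = g (gen K E x)) : f = g := by
  ext a
  induction a using LeavittPathAlgebra.induction with
  | zero => rw [map_zero, map_zero]
  | add a b ha hb => rw [map_add, map_add, ha, hb]
  | smul k a ha => rw [map_smul, map_smul, ha]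
  | gen x => exact h x
  | gen_mul x a ha => rw [map_mul, map_mul, h, ha]

/-- The canonical anti-automorphism of `L_K(E)`, as a homomorphism to the opposite algebra. -/
def starHom : LeavittPathAlgebra K E →ₙₐ[K] (LeavittPathAlgebra K E)ᵐᵒᵖ :=
  lift K (fun g => MulOpposite.op (gen K E g.adjoint))
    { vert_idem a := congrArg _ ((isCuntzKriegerFamily_gen K E).vert_idem a)
      vert_orth a b h := congrArg _ ((isCuntzKriegerFamily_gen K E).vert_orth b a h.symm)
      source_edge e := congrArg _ ((isCuntzKriegerFamily_gen K E).ghost_source e)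
      edge_range e := congrArg _ ((isCuntzKriegerFamily_gen K E).range_ghost e)
      range_ghost e := congrArg _ ((isCuntzKriegerFamily_gen K E).edge_range e)
      ghost_source e := congrArg _ ((isCuntzKriegerFamily_gen K E).source_edge e)
      ghost_edge_self e := congrArg _ ((isCuntzKriegerFamily_gen K E).ghost_edge_self e)
      ghost_edge_ne e d h := congrArg _ ((isCuntzKriegerFamily_gen K E).ghost_edge_ne d e h.symm)
      regular_vert a hfin hne :=
        (congrArg _ ((isCuntzKriegerFamily_gen K E).regular_vert a hfin hne)).trans
          (Finset.op_sum _ _) }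

theorem starHom_gen (g : LeavittGen V Ed) :
    starHom (gen K E g) = MulOpposite.op (gen K E g.adjoint) :=
  lift_gen K _ _ g

instance : StarRing (LeavittPathAlgebra K E) where
  star a := (starHom a).unop
  star_involutive a := by
    change (starHom (starHom a).unop).unop = a
    induction a using LeavittPathAlgebra.induction with
    | zero => simp
    | add a b ha hb => simp [ha, hb]
    | smul k a ha => simp [ha]
    | gen g => simp [starHom_gen, adjoint_adjoint]
    | gen_mul g a ha => simp [starHom_gen, adjoint_adjoint, ha]
  star_mul a b := by simp
  star_add a b := by simp

theorem star_gen (g : LeavittGen V Ed) : star (gen K E g) = gen K E g.adjoint :=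
  congrArg MulOpposite.unop (starHom_gen g)

theorem star_smul (k : K) (a : LeavittPathAlgebra K E) : star (k • a) = k • star a :=
  congrArg MulOpposite.unop (map_smul starHom k a)

theorem map_star_of_map_gen_adjoint {V' Ed' : Type*} {E' : DirectedGraph V' Ed'}
    {f : LeavittPathAlgebra K E →ₙₐ[K] LeavittPathAlgebra K E'}
    (hf : ∀ g, f (gen K E g.adjoint) = star (f (gen K E g))) (a : LeavittPathAlgebra K E) :
    f (star a) = star (f a) := by
  induction a using LeavittPathAlgebra.induction with
  | zero => simp only [star_zero, map_zero]
  | add a b ha hb => simp only [star_add, map_add, ha, hb]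
  | smul k a ha => simp only [star_smul, map_smul, ha]
  | gen g => rw [star_gen, hf]
  | gen_mul g a ha => simp only [star_mul, map_mul, star_gen, hf, ha]

theorem eventually_sum_ofVert_mul_eq_self (b : LeavittPathAlgebra K E) :
    ∀ᶠ t : Finset V in Filter.atTop, (∑ a ∈ t, ofVert K E a) * b = b := by
  have unit_gen (g : LeavittGen V Ed) :
      ∀ᶠ t : Finset V in Filter.atTop, (∑ a ∈ t, ofVert K E a) * gen K E g = gen K E g := by
    obtain ⟨a, ha⟩ := exists_ofVert_mul_gen K E g
    filter_upwards [Filter.eventually_ge_atTop {a}] with t ht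
    have sum_mul : (∑ b ∈ t, ofVert K E b) * ofVert K E a = ofVert K E a := by
      rw [Finset.sum_mul]
      exact (Finset.sum_eq_single_of_mem a (ht (Finset.mem_singleton_self a)) fun b _ hb =>
        (isCuntzKriegerFamily_gen K E).vert_orth b a hb).trans
          ((isCuntzKriegerFamily_gen K E).vert_idem a)
    rw [← ha, ← mul_assoc, sum_mul]
  induction b using LeavittPathAlgebra.induction with
  | zero => exact .of_forall fun t => mul_zero _
  | add a b ha hb => filter_upwards [ha, hb] with t ha hb using by rw [mul_add, ha, hb]
  | smul k a ha => filter_upwards [ha] with t ha using by rw [mul_smul_comm, ha]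
  | gen g => exact unit_gen g
  | gen_mul g a _ => filter_upwards [unit_gen g] with t hg using by rw [← mul_assoc, hg]

theorem mem_of_forall_ofVert_mul_mem {S : Type*} [SetLike S (LeavittPathAlgebra K E)]
    [AddSubmonoidClass S (LeavittPathAlgebra K E)] {s : S} {b : LeavittPathAlgebra K E}
    (h : ∀ a, ofVert K E a * b ∈ s) : b ∈ s := by
  obtain ⟨t, ht⟩ := (eventually_sum_ofVert_mul_eq_self b).exists
  rw [← ht, Finset.sum_mul]
  exact sum_mem fun a _ => h a

theorem hasLeftLocalUnits : HasLeftLocalUnits (LeavittPathAlgebra K E) := by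
  intro s
  obtain ⟨t, ht⟩ := ((Filter.eventually_all_finset s).2 fun b _ =>
    eventually_sum_ofVert_mul_eq_self b).exists
  exact ⟨_, ht⟩

theorem exists_mul_eq_self (b : LeavittPathAlgebra K E) : ∃ u, b * u = b := by
  obtain ⟨u, hu⟩ := hasLeftLocalUnits.exists_mul_eq_self (star b)
  exact ⟨star u, by rw [← star_inj, star_mul, star_star, hu]⟩

end LeavittPathAlgebra

/-- An embedding of the graph `G` onto a hereditary subgraph of `E`: every edge of `E` that starts
at a vertex of `G` is an edge of `G`. -/
structure DirectedGraph.HereditaryEmbedding {W V : Type*} {D Ed : Type*} (G : DirectedGraph W D)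
    (E : DirectedGraph V Ed) where
  vertMap : W → V
  edgeMap : D → Ed
  vertMap_injective : Function.Injective vertMap
  edgeMap_injective : Function.Injective edgeMap
  s_edgeMap : ∀ d, E.s (edgeMap d) = vertMap (G.s d)
  r_edgeMap : ∀ d, E.r (edgeMap d) = vertMap (G.r d)
  mem_range_edgeMap : ∀ e, E.s e ∈ Set.range vertMap → e ∈ Set.range edgeMap

namespace DirectedGraph

/-- The inclusion of the restriction of `E` to a hereditary set. -/
def Hereditary.embedding {V : Type*} {Ed : Type*} {E : DirectedGraph V Ed} {H : Set V}
    (hH : E.Hereditary H) : HereditaryEmbedding (E.restrict H hH) E where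
  vertMap := Subtype.val
  edgeMap := Subtype.val
  vertMap_injective := Subtype.val_injective
  edgeMap_injective := Subtype.val_injective
  s_edgeMap _ := rfl
  r_edgeMap _ := rfl
  mem_range_edgeMap e he := ⟨⟨e, Subtype.range_val.subset he⟩, rfl⟩

namespace HereditaryEmbedding

variable {W : Type x} {V : Type v} {D : Type*} {Ed : Type w} {G : DirectedGraph W D}
  {E : DirectedGraph V Ed} (J : G.HereditaryEmbedding E)

/-- The map induced on generating symbols. -/
def mapGen : LeavittGen W D → LeavittGen V Ed := LeavittGen.map J.vertMap J.edgeMap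

theorem mapGen_injective : Function.Injective J.mapGen :=
  LeavittGen.map_injective J.vertMap_injective J.edgeMap_injective

theorem s_preimage_vertMap (w : W) : E.s ⁻¹' {J.vertMap w} = J.edgeMap '' (G.s ⁻¹' {w}) := by
  ext e
  constructor
  · intro he
    obtain ⟨d, rfl⟩ := J.mem_range_edgeMap e ⟨w, he.symm⟩
    exact ⟨d, J.vertMap_injective ((J.s_edgeMap d).symm.trans he), rfl⟩
  · rintro ⟨d, rfl, rfl⟩
    exact J.s_edgeMap d

theorem sum_s_preimage {A : Type*} [AddCommMonoid A] {w : W} (hG : (G.s ⁻¹' {w}).Finite)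
    (hE : (E.s ⁻¹' {J.vertMap w}).Finite) (f : Ed → A) :
    ∑ e ∈ hE.toFinset, f e = ∑ d ∈ hG.toFinset, f (J.edgeMap d) := by
  classical
  have toFinset_eq : hE.toFinset = hG.toFinset.image J.edgeMap := by
    rw [← Finset.coe_inj, Finset.coe_image, hE.coe_toFinset, hG.coe_toFinset,
      J.s_preimage_vertMap]
  rw [toFinset_eq, Finset.sum_image J.edgeMap_injective.injOn]

theorem isCuntzKriegerFamily_comp_mapGen {A : Type*} [NonUnitalRing A] {f : LeavittGen V Ed → A}
    (hf : IsCuntzKriegerFamily E f) : IsCuntzKriegerFamily G (f ∘ J.mapGen) where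
  vert_idem a := hf.vert_idem _
  vert_orth a b h := hf.vert_orth _ _ (J.vertMap_injective.ne h)
  source_edge d := by
    simpa only [Function.comp_apply, mapGen, LeavittGen.map, J.s_edgeMap] using
      hf.source_edge (J.edgeMap d)
  edge_range d := by
    simpa only [Function.comp_apply, mapGen, LeavittGen.map, J.r_edgeMap] using
      hf.edge_range (J.edgeMap d)
  range_ghost d := by
    simpa only [Function.comp_apply, mapGen, LeavittGen.map, J.r_edgeMap] using
      hf.range_ghost (J.edgeMap d)
  ghost_source d := by
    simpa only [Function.comp_apply, mapGen, LeavittGen.map, J.s_edgeMap] using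
      hf.ghost_source (J.edgeMap d)
  ghost_edge_self d :=
    (hf.ghost_edge_self (J.edgeMap d)).trans (congrArg (f ∘ vert) (J.r_edgeMap d))
  ghost_edge_ne d d' h := hf.ghost_edge_ne _ _ (J.edgeMap_injective.ne h)
  regular_vert w hfin hne := by
    have himage := J.s_preimage_vertMap w
    have hfin' : (E.s ⁻¹' {J.vertMap w}).Finite := himage ▸ hfin.image _
    exact (hf.regular_vert _ hfin' (himage ▸ hne.image _)).trans (J.sum_s_preimage hfin hfin' _)

variable (K : Type u) [Field K]

/-- The homomorphism `L_K(G) → L_K(E)` induced by a hereditary embedding. -/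
def hom : LeavittPathAlgebra K G →ₙₐ[K] LeavittPathAlgebra K E :=
  LeavittPathAlgebra.lift K (LeavittPathAlgebra.gen K E ∘ J.mapGen)
    (J.isCuntzKriegerFamily_comp_mapGen (LeavittPathAlgebra.isCuntzKriegerFamily_gen K E))

theorem hom_gen (g : LeavittGen W D) :
    J.hom K (LeavittPathAlgebra.gen K G g) = LeavittPathAlgebra.gen K E (J.mapGen g) :=
  LeavittPathAlgebra.lift_gen K _ _ g

theorem hom_star (a : LeavittPathAlgebra K G) : J.hom K (star a) = star (J.hom K a) :=
  LeavittPathAlgebra.map_star_of_map_gen_adjoint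
    (fun g => by rw [hom_gen, hom_gen, LeavittPathAlgebra.star_gen, mapGen, adjoint_map]) a

theorem _root_.LeavittPathAlgebra.restrictHom_eq_hom {H : Set V} (hH : E.Hereditary H) :
    LeavittPathAlgebra.restrictHom K hH = hH.embedding.hom K :=
  LeavittPathAlgebra.hom_ext fun g => by
    rw [hom_gen]
    exact (LeavittPathAlgebra.lift_gen K _ _ g).trans (by cases g <;> rfl)

end HereditaryEmbedding

end DirectedGraph

namespace DirectedGraph.HereditaryEmbedding

variable {W : Type x} {V : Type v} {D : Type*} {Ed : Type w} {G : DirectedGraph W D}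
  {E : DirectedGraph V Ed} (J : G.HereditaryEmbedding E)

theorem exists_mapGen_eq_of_s_mem_range {e : Ed} (he : E.s e ∈ Set.range J.vertMap) : ∃ d,
    J.mapGen (vert (G.s d)) = vert (E.s e) ∧ J.mapGen (vert (G.r d)) = vert (E.r e) ∧
      J.mapGen (edge d) = edge e ∧ J.mapGen (ghost d) = ghost e := by
  obtain ⟨d, rfl⟩ := J.mem_range_edgeMap e he
  exact ⟨d, congrArg vert (J.s_edgeMap d).symm, congrArg vert (J.r_edgeMap d).symm, rfl, rfl⟩

theorem r_mem_range {e : Ed} (he : E.s e ∈ Set.range J.vertMap) :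
    E.r e ∈ Set.range J.vertMap := by
  obtain ⟨d, rfl⟩ := J.mem_range_edgeMap e he
  exact ⟨G.r d, (J.r_edgeMap d).symm⟩

section PathRepresentation

variable {K N : Type*} [Field K] [AddCommGroup N] [Module K N]
  (f : LeavittGen W D → Module.End K N)

/-- The extension by zero, to the generating symbols of `E`, of a family indexed by those of
`G`. -/
def extendGen : LeavittGen V Ed → Module.End K N := Function.extend J.mapGen f 0

theorem extendGen_mapGen (g : LeavittGen W D) : J.extendGen f (J.mapGen g) = f g :=
  J.mapGen_injective.extend_apply f 0 g

theorem extendGen_vert_of_notMem {a : V} (ha : a ∉ Set.range J.vertMap) :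
    J.extendGen f (vert a) = 0 := by
  refine Function.extend_apply' _ _ _ ?_
  rintro ⟨_ | _ | _, h⟩ <;> simp only [mapGen, LeavittGen.map, reduceCtorEq] at h
  exact ha ⟨_, vert.inj h⟩

theorem extendGen_edge_of_notMem {e : Ed} (he : E.s e ∉ Set.range J.vertMap) :
    J.extendGen f (edge e) = 0 := by
  refine Function.extend_apply' _ _ _ ?_
  rintro ⟨_ | d | _, h⟩ <;> simp only [mapGen, LeavittGen.map, reduceCtorEq] at h
  exact he ⟨_, edge.inj h ▸ (J.s_edgeMap d).symm⟩

theorem extendGen_ghost_of_notMem {e : Ed} (he : E.s e ∉ Set.range J.vertMap) :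
    J.extendGen f (ghost e) = 0 := by
  refine Function.extend_apply' _ _ _ ?_
  rintro ⟨_ | _ | d, h⟩ <;> simp only [mapGen, LeavittGen.map, reduceCtorEq] at h
  exact he ⟨_, ghost.inj h ▸ (J.s_edgeMap d).symm⟩

open Classical in
/-- The projection of `N` onto the component of the path representation at the list `l` of edges
that belongs to the vertex `a`. It vanishes unless `l` is a path that starts at `a` and first
enters `G` at its end. -/
def pathProj : V → List Ed → Module.End K N
  | a, [] => J.extendGen f (vert a)
  | a, e :: l => if E.s e = a ∧ a ∉ Set.range J.vertMap then pathProj (E.r e) l else 0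

open Classical in
/-- The path representation of `E` on the functions from lists of edges to `N`: the edges outside
`G` shift the lists, and the edges of `G` act by `f` at the empty list. -/
def pathRep : LeavittGen V Ed → Module.End K (List Ed → N)
  | vert a => LinearMap.pi fun l => J.pathProj f a l ∘ₗ LinearMap.proj l
  | edge e => LinearMap.pi fun
    | [] => J.extendGen f (edge e) ∘ₗ LinearMap.proj []
    | d :: l => if d = e then J.pathProj f (E.s e) (e :: l) ∘ₗ LinearMap.proj l else 0
  | ghost e => LinearMap.pi fun l => J.pathProj f (E.s e) (e :: l) ∘ₗ LinearMap.proj (e :: l) +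
      if l = [] then J.extendGen f (ghost e) ∘ₗ LinearMap.proj [] else 0

theorem pathRep_vert (a : V) (p : List Ed → N) (l : List Ed) :
    J.pathRep f (vert a) p l = J.pathProj f a l (p l) := rfl

theorem pathRep_edge_nil (e : Ed) (p : List Ed → N) :
    J.pathRep f (edge e) p [] = J.extendGen f (edge e) (p []) := rfl

open Classical in
theorem pathRep_edge_cons (e d : Ed) (p : List Ed → N) (l : List Ed) :
    J.pathRep f (edge e) p (d :: l) =
      if d = e then J.pathProj f (E.s e) (e :: l) (p l) else 0 := by
  simp only [pathRep, LinearMap.pi_apply]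
  split_ifs <;> rfl

open Classical in
theorem pathRep_ghost (e : Ed) (p : List Ed → N) (l : List Ed) :
    J.pathRep f (ghost e) p l = J.pathProj f (E.s e) (e :: l) (p (e :: l)) +
      if l = [] then J.extendGen f (ghost e) (p []) else 0 := by
  simp only [pathRep, LinearMap.pi_apply, LinearMap.add_apply]
  split_ifs <;> rfl

variable {f} (hf : IsCuntzKriegerFamily G f)

theorem pathProj_cons_of_mem (a : V) {e : Ed} (l : List Ed) (he : E.s e ∈ Set.range J.vertMap) :
    J.pathProj f a (e :: l) = 0 :=
  if_neg fun h => h.2 (h.1 ▸ he)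

theorem pathProj_cons_of_notMem {e : Ed} (l : List Ed) (he : E.s e ∉ Set.range J.vertMap) :
    J.pathProj f (E.s e) (e :: l) = J.pathProj f (E.r e) l :=
  if_pos ⟨rfl, he⟩

theorem pathProj_cons_of_ne {a : V} {e : Ed} (l : List Ed) (h : E.s e ≠ a) :
    J.pathProj f a (e :: l) = 0 :=
  if_neg fun h' => h h'.1

theorem extendGen_edge_mul_pathProj (e : Ed) (l : List Ed) :
    J.extendGen f (edge e) * J.pathProj f (E.s e) (e :: l) = 0 := by
  by_cases he : E.s e ∈ Set.range J.vertMap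
  · rw [J.pathProj_cons_of_mem _ l he, mul_zero]
  · rw [J.extendGen_edge_of_notMem f he, zero_mul]

theorem pathProj_mul_extendGen_ghost (e : Ed) (l : List Ed) :
    J.pathProj f (E.s e) (e :: l) * J.extendGen f (ghost e) = 0 := by
  by_cases he : E.s e ∈ Set.range J.vertMap
  · rw [J.pathProj_cons_of_mem _ l he, zero_mul]
  · rw [J.extendGen_ghost_of_notMem f he, mul_zero]

theorem pathRep_edge_pathRep_ghost_nil (e : Ed) (p : List Ed → N) :
    J.pathRep f (edge e) (J.pathRep f (ghost e) p) [] =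
      J.extendGen f (edge e) (J.extendGen f (ghost e) (p [])) := by
  rw [pathRep_edge_nil, pathRep_ghost, if_pos rfl, map_add, ← Module.End.mul_apply,
    extendGen_edge_mul_pathProj, LinearMap.zero_apply, zero_add]

include hf

theorem extendGen_vert_mul_self (a : V) :
    J.extendGen f (vert a) * J.extendGen f (vert a) = J.extendGen f (vert a) := by
  by_cases ha : a ∈ Set.range J.vertMap
  · obtain ⟨w, rfl⟩ := ha
    exact (J.extendGen_mapGen f (vert w)).symm ▸ hf.vert_idem w
  · rw [J.extendGen_vert_of_notMem f ha, mul_zero]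

theorem extendGen_vert_mul_vert {a b : V} (hab : a ≠ b) :
    J.extendGen f (vert a) * J.extendGen f (vert b) = 0 := by
  by_cases ha : a ∈ Set.range J.vertMap
  · by_cases hb : b ∈ Set.range J.vertMap
    · obtain ⟨w, rfl⟩ := ha
      obtain ⟨w', rfl⟩ := hb
      exact (congrArg₂ _ (J.extendGen_mapGen f (vert w)) (J.extendGen_mapGen f (vert w'))).trans
        (hf.vert_orth w w' fun h => hab (congrArg _ h))
    · rw [J.extendGen_vert_of_notMem f hb, mul_zero]
  · rw [J.extendGen_vert_of_notMem f ha, zero_mul]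

theorem extendGen_vert_mul_edge (e : Ed) :
    J.extendGen f (vert (E.s e)) * J.extendGen f (edge e) = J.extendGen f (edge e) := by
  by_cases he : E.s e ∈ Set.range J.vertMap
  · obtain ⟨d, hs, -, hd, -⟩ := J.exists_mapGen_eq_of_s_mem_range he
    rw [← hs, ← hd, extendGen_mapGen, extendGen_mapGen, hf.source_edge]
  · rw [J.extendGen_edge_of_notMem f he, mul_zero]

theorem extendGen_edge_mul_vert (e : Ed) :
    J.extendGen f (edge e) * J.extendGen f (vert (E.r e)) = J.extendGen f (edge e) := by
  by_cases he : E.s e ∈ Set.range J.vertMap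
  · obtain ⟨d, -, hr, hd, -⟩ := J.exists_mapGen_eq_of_s_mem_range he
    rw [← hr, ← hd, extendGen_mapGen, extendGen_mapGen, hf.edge_range]
  · rw [J.extendGen_edge_of_notMem f he, zero_mul]

theorem extendGen_vert_mul_ghost (e : Ed) :
    J.extendGen f (vert (E.r e)) * J.extendGen f (ghost e) = J.extendGen f (ghost e) := by
  by_cases he : E.s e ∈ Set.range J.vertMap
  · obtain ⟨d, -, hr, -, hd⟩ := J.exists_mapGen_eq_of_s_mem_range he
    rw [← hr, ← hd, extendGen_mapGen, extendGen_mapGen, hf.range_ghost]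
  · rw [J.extendGen_ghost_of_notMem f he, mul_zero]

theorem extendGen_ghost_mul_vert (e : Ed) :
    J.extendGen f (ghost e) * J.extendGen f (vert (E.s e)) = J.extendGen f (ghost e) := by
  by_cases he : E.s e ∈ Set.range J.vertMap
  · obtain ⟨d, hs, -, -, hd⟩ := J.exists_mapGen_eq_of_s_mem_range he
    rw [← hs, ← hd, extendGen_mapGen, extendGen_mapGen, hf.ghost_source]
  · rw [J.extendGen_ghost_of_notMem f he, zero_mul]

theorem extendGen_ghost_mul_edge_of_ne {e e' : Ed} (h : e ≠ e') :
    J.extendGen f (ghost e) * J.extendGen f (edge e') = 0 := by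
  by_cases he : E.s e ∈ Set.range J.vertMap
  · by_cases he' : E.s e' ∈ Set.range J.vertMap
    · obtain ⟨d, rfl⟩ := J.mem_range_edgeMap e he
      obtain ⟨d', rfl⟩ := J.mem_range_edgeMap e' he'
      exact (congrArg₂ _ (J.extendGen_mapGen f (ghost d)) (J.extendGen_mapGen f (edge d'))).trans
        (hf.ghost_edge_ne d d' fun hd => h (congrArg _ hd))
    · rw [J.extendGen_edge_of_notMem f he', mul_zero]
  · rw [J.extendGen_ghost_of_notMem f he, zero_mul]

theorem extendGen_vert_eq_sum (a : V) (hfin : (E.s ⁻¹' {a}).Finite)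
    (hne : (E.s ⁻¹' {a}).Nonempty) : J.extendGen f (vert a) =
      ∑ e ∈ hfin.toFinset, J.extendGen f (edge e) * J.extendGen f (ghost e) := by
  by_cases ha : a ∈ Set.range J.vertMap
  · obtain ⟨w, rfl⟩ := ha
    have himage := J.s_preimage_vertMap w
    have hfin' : (G.s ⁻¹' {w}).Finite :=
      Set.Finite.of_finite_image (himage ▸ hfin) J.edgeMap_injective.injOn
    refine (J.extendGen_mapGen f (vert w)).trans ((hf.regular_vert w hfin' ?_).trans
      ((Finset.sum_congr rfl fun d _ => ?_).trans (J.sum_s_preimage hfin' hfin _).symm))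
    · exact Set.image_nonempty.1 (himage ▸ hne)
    · exact (congrArg₂ _ (J.extendGen_mapGen f (edge d)) (J.extendGen_mapGen f (ghost d))).symm
  · rw [J.extendGen_vert_of_notMem f ha, Finset.sum_eq_zero fun e he => ?_]
    have he' : E.s e = a := hfin.mem_toFinset.1 he
    rw [J.extendGen_edge_of_notMem f (he' ▸ ha), zero_mul]

theorem pathProj_mul_self (a : V) (l : List Ed) :
    J.pathProj f a l * J.pathProj f a l = J.pathProj f a l := by
  induction l generalizing a with
  | nil => exact J.extendGen_vert_mul_self hf a
  | cons e l ih =>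
    rw [pathProj]
    split_ifs
    · exact ih _
    · exact mul_zero _

theorem pathProj_mul_of_ne {a b : V} (hab : a ≠ b) (l : List Ed) :
    J.pathProj f a l * J.pathProj f b l = 0 := by
  cases l with
  | nil => exact J.extendGen_vert_mul_vert hf hab
  | cons e l =>
    by_cases h : E.s e = a
    · rw [J.pathProj_cons_of_ne l (h.trans_ne hab), mul_zero]
    · rw [J.pathProj_cons_of_ne l h, zero_mul]

theorem pathProj_range_mul_pathProj_cons (e : Ed) (l : List Ed) :
    J.pathProj f (E.r e) l * J.pathProj f (E.s e) (e :: l) = J.pathProj f (E.s e) (e :: l) := by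
  by_cases he : E.s e ∈ Set.range J.vertMap
  · rw [J.pathProj_cons_of_mem _ l he, mul_zero]
  · rw [J.pathProj_cons_of_notMem l he, J.pathProj_mul_self hf]

theorem pathProj_cons_mul_pathProj_range (e : Ed) (l : List Ed) :
    J.pathProj f (E.s e) (e :: l) * J.pathProj f (E.r e) l = J.pathProj f (E.s e) (e :: l) := by
  by_cases he : E.s e ∈ Set.range J.vertMap
  · rw [J.pathProj_cons_of_mem _ l he, zero_mul]
  · rw [J.pathProj_cons_of_notMem l he, J.pathProj_mul_self hf]

theorem pathProj_cons_add_ghost_mul_edge (e : Ed) (l : List Ed) :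
    J.pathProj f (E.s e) (e :: l) +
      (if l = [] then J.extendGen f (ghost e) * J.extendGen f (edge e) else 0) =
      J.pathProj f (E.r e) l := by
  by_cases he : E.s e ∈ Set.range J.vertMap
  · rw [J.pathProj_cons_of_mem _ l he, zero_add]
    cases l with
    | nil =>
      obtain ⟨d, -, hr, hd, hd'⟩ := J.exists_mapGen_eq_of_s_mem_range he
      rw [if_pos rfl, pathProj, ← hr, ← hd, ← hd', extendGen_mapGen, extendGen_mapGen,
        extendGen_mapGen, hf.ghost_edge_self]
    | cons d l =>
      rw [if_neg (List.cons_ne_nil d l), pathProj, if_neg fun h => h.2 (J.r_mem_range he)]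
  · rw [J.pathProj_cons_of_notMem l he, J.extendGen_edge_of_notMem f he, mul_zero, ite_self,
      add_zero]

open Classical in
theorem pathRep_edge_pathRep_ghost_cons (e d : Ed) (p : List Ed → N) (l : List Ed) :
    J.pathRep f (edge e) (J.pathRep f (ghost e) p) (d :: l) =
      if d = e then J.pathProj f (E.s d) (d :: l) (p (d :: l)) else 0 := by
  rw [pathRep_edge_cons]
  split_ifs with h
  · subst h
    rw [pathRep_ghost, map_add, ← Module.End.mul_apply, J.pathProj_mul_self hf]
    split_ifs
    · rw [← Module.End.mul_apply, pathProj_mul_extendGen_ghost, LinearMap.zero_apply, add_zero]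
    · rw [map_zero, add_zero]
  · rfl

theorem pathRep_vert_mul_edge (e : Ed) :
    J.pathRep f (vert (E.s e)) * J.pathRep f (edge e) = J.pathRep f (edge e) := by
  refine LinearMap.ext fun p => funext fun l => ?_
  rw [Module.End.mul_apply, pathRep_vert]
  cases l with
  | nil => exact LinearMap.congr_fun (J.extendGen_vert_mul_edge hf e) (p [])
  | cons d l =>
    rw [pathRep_edge_cons]
    split_ifs with h
    · exact h ▸ LinearMap.congr_fun (J.pathProj_mul_self hf (E.s e) (e :: l)) (p l)
    · exact map_zero _

theorem pathRep_edge_mul_vert (e : Ed) :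
    J.pathRep f (edge e) * J.pathRep f (vert (E.r e)) = J.pathRep f (edge e) := by
  refine LinearMap.ext fun p => funext fun l => ?_
  rw [Module.End.mul_apply]
  cases l with
  | nil => exact LinearMap.congr_fun (J.extendGen_edge_mul_vert hf e) (p [])
  | cons d l =>
    rw [pathRep_edge_cons, pathRep_edge_cons, pathRep_vert, ← Module.End.mul_apply,
      J.pathProj_cons_mul_pathProj_range hf]

theorem pathRep_vert_mul_ghost (e : Ed) :
    J.pathRep f (vert (E.r e)) * J.pathRep f (ghost e) = J.pathRep f (ghost e) := by
  refine LinearMap.ext fun p => funext fun l => ?_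
  rw [Module.End.mul_apply, pathRep_vert, pathRep_ghost, map_add, ← Module.End.mul_apply,
    J.pathProj_range_mul_pathProj_cons hf]
  split_ifs with hl
  · subst hl
    exact congrArg _ (LinearMap.congr_fun (J.extendGen_vert_mul_ghost hf e) (p []))
  · rw [map_zero]

theorem pathRep_ghost_mul_vert (e : Ed) :
    J.pathRep f (ghost e) * J.pathRep f (vert (E.s e)) = J.pathRep f (ghost e) := by
  refine LinearMap.ext fun p => funext fun l => ?_
  rw [Module.End.mul_apply, pathRep_ghost, pathRep_ghost, pathRep_vert, pathRep_vert,
    ← Module.End.mul_apply, J.pathProj_mul_self hf]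
  congr 2
  exact LinearMap.congr_fun (J.extendGen_ghost_mul_vert hf e) (p [])

theorem pathRep_ghost_mul_edge_self (e : Ed) :
    J.pathRep f (ghost e) * J.pathRep f (edge e) = J.pathRep f (vert (E.r e)) := by
  refine LinearMap.ext fun p => funext fun l => ?_
  rw [Module.End.mul_apply, pathRep_ghost, pathRep_edge_cons, pathRep_edge_nil, if_pos rfl,
    pathRep_vert, ← J.pathProj_cons_add_ghost_mul_edge hf, ← Module.End.mul_apply,
    J.pathProj_mul_self hf, LinearMap.add_apply]
  split_ifs with hl
  · rw [hl]; rfl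
  · rfl

theorem pathRep_ghost_mul_edge_of_ne {e d : Ed} (h : e ≠ d) :
    J.pathRep f (ghost e) * J.pathRep f (edge d) = 0 := by
  refine LinearMap.ext fun p => funext fun l => ?_
  rw [Module.End.mul_apply, pathRep_ghost, pathRep_edge_cons, pathRep_edge_nil, if_neg h,
    map_zero, ← Module.End.mul_apply, J.extendGen_ghost_mul_edge_of_ne hf h, zero_add]
  exact ite_self _

theorem pathRep_vert_eq_sum (a : V) (hfin : (E.s ⁻¹' {a}).Finite)
    (hne : (E.s ⁻¹' {a}).Nonempty) : J.pathRep f (vert a) =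
      ∑ e ∈ hfin.toFinset, J.pathRep f (edge e) * J.pathRep f (ghost e) := by
  refine LinearMap.ext fun p => funext fun l => ?_
  rw [LinearMap.sum_apply, Finset.sum_apply, pathRep_vert]
  simp only [Module.End.mul_apply]
  cases l with
  | nil =>
    rw [pathProj, J.extendGen_vert_eq_sum hf a hfin hne, LinearMap.sum_apply]
    exact Finset.sum_congr rfl fun e _ => (J.pathRep_edge_pathRep_ghost_nil e p).symm
  | cons e l =>
    classical
    simp only [J.pathRep_edge_pathRep_ghost_cons hf, Finset.sum_ite_eq, hfin.mem_toFinset,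
      Set.mem_preimage, Set.mem_singleton_iff]
    split_ifs with h
    · rw [h]
    · rw [J.pathProj_cons_of_ne l h, LinearMap.zero_apply]

theorem isCuntzKriegerFamily_pathRep : IsCuntzKriegerFamily E (J.pathRep f) where
  vert_idem a := by
    ext p l
    exact LinearMap.congr_fun (J.pathProj_mul_self hf a l) (p l)
  vert_orth a b h := by
    ext p l
    exact LinearMap.congr_fun (J.pathProj_mul_of_ne hf h l) (p l)
  source_edge := J.pathRep_vert_mul_edge hf
  edge_range := J.pathRep_edge_mul_vert hf
  range_ghost := J.pathRep_vert_mul_ghost hf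
  ghost_source := J.pathRep_ghost_mul_vert hf
  ghost_edge_self := J.pathRep_ghost_mul_edge_self hf
  ghost_edge_ne _ _ := J.pathRep_ghost_mul_edge_of_ne hf
  regular_vert := J.pathRep_vert_eq_sum hf

omit hf in
theorem pathRep_mapGen_nil (g : LeavittGen W D) (p : List Ed → N) :
    J.pathRep f (J.mapGen g) p [] = f g (p []) := by
  rw [← J.extendGen_mapGen f g]
  cases g with
  | vert w => rfl
  | edge d => rfl
  | ghost d =>
    refine (J.pathRep_ghost f _ p []).trans ?_
    rw [J.pathProj_cons_of_mem _ [] ⟨G.s d, (J.s_edgeMap d).symm⟩, if_pos rfl]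
    exact zero_add _

end PathRepresentation

open LeavittPathAlgebra in
theorem hom_injective (K : Type*) [Field K] : Function.Injective (J.hom K) := by
  let X := Unitization K (LeavittPathAlgebra K G)
  let regular : LeavittPathAlgebra K G →ₙₐ[K] Module.End K X :=
    (Algebra.lmul K X : X →ₙₐ[K] Module.End K X).comp (Unitization.inrNonUnitalAlgHom K _)
  have hregular : IsCuntzKriegerFamily G fun g => regular (gen K G g) :=
    (isCuntzKriegerFamily_gen K G).map regular
  let rep := lift K _ (J.isCuntzKriegerFamily_pathRep hregular)
  have rep_nil (a : LeavittPathAlgebra K G) (p : List Ed → X) :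
      rep (J.hom K a) p [] = regular a (p []) := by
    induction a using LeavittPathAlgebra.induction generalizing p with
    | zero => simp only [map_zero]; rfl
    | add a b ha hb => simp only [map_add, LinearMap.add_apply, Pi.add_apply, ha, hb]
    | smul k a ha => simp only [map_smul, LinearMap.smul_apply, Pi.smul_apply, ha]
    | gen g => rw [hom_gen, lift_gen, pathRep_mapGen_nil]
    | gen_mul g a ha =>
      rw [map_mul, map_mul, map_mul, Module.End.mul_apply, Module.End.mul_apply, ← ha, hom_gen,
        lift_gen, pathRep_mapGen_nil]
  refine (injective_iff_map_eq_zero _).2 fun a ha => Unitization.inr_injective (R := K) ?_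
  have h := rep_nil a fun _ => 1
  rw [ha, map_zero] at h
  exact (mul_one (a : X)).symm.trans h.symm

end DirectedGraph.HereditaryEmbedding

namespace DirectedGraph.HereditaryEmbedding

open LeavittPathAlgebra

variable {W : Type x} {V : Type v} {D : Type*} {Ed : Type w} {G : DirectedGraph W D}
  {E : DirectedGraph V Ed} (J : G.HereditaryEmbedding E)

/-- The list `l` of edges is a path of `E` that starts at `a`, ends at the vertex `w` of `G` and
meets no other vertex of `G`. -/
inductive Enters : V → List Ed → W → Prop
  | nil (w : W) : Enters (J.vertMap w) [] w
  | cons {e : Ed} {l : List Ed} {w : W} (he : E.s e ∉ Set.range J.vertMap)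
      (h : Enters (E.r e) l w) : Enters (E.s e) (e :: l) w

variable {J}

theorem Enters.unique {a : V} {l : List Ed} {w w' : W} (h : J.Enters a l w)
    (h' : J.Enters a l w') : w = w' := by
  generalize ha : a = a' at h'
  induction h generalizing a' with
  | nil w =>
    cases h'
    exact J.vertMap_injective ha
  | cons _ _ ih =>
    cases h' with
    | cons _ h' => exact ih _ rfl h'

variable (J) (K : Type u) [Field K]

/-- The product in `L_K(E)` of the edges of the list `l` and the vertex `w`. -/
def pathElt (l : List Ed) (w : W) : LeavittPathAlgebra K E :=
  l.foldr (fun e b => ofEdge K E e * b) (ofVert K E (J.vertMap w))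

theorem pathElt_nil (w : W) : J.pathElt K [] w = J.hom K (gen K G (vert w)) :=
  (J.hom_gen K (vert w)).symm

theorem pathElt_cons (e : Ed) (l : List Ed) (w : W) :
    J.pathElt K (e :: l) w = ofEdge K E e * J.pathElt K l w := rfl

theorem star_pathElt_nil (w : W) : star (J.pathElt K [] w) = J.pathElt K [] w :=
  star_gen (vert (J.vertMap w))

theorem pathElt_mul_ofVert (l : List Ed) (w : W) :
    J.pathElt K l w * ofVert K E (J.vertMap w) = J.pathElt K l w := by
  induction l with
  | nil => exact (isCuntzKriegerFamily_gen K E).vert_idem _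
  | cons e l ih => rw [pathElt_cons, mul_assoc, ih]

variable {J}

theorem Enters.ofVert_mul_pathElt {a : V} {l : List Ed} {w : W} (h : J.Enters a l w) :
    ofVert K E a * J.pathElt K l w = J.pathElt K l w := by
  cases h with
  | nil w => exact (isCuntzKriegerFamily_gen K E).vert_idem _
  | cons he h =>
    rw [pathElt_cons, ← mul_assoc]
    exact congrArg (· * _) ((isCuntzKriegerFamily_gen K E).source_edge _)

theorem Enters.ofVert_mul_pathElt_of_ne {a b : V} {l : List Ed} {w : W} (h : J.Enters a l w)
    (hab : b ≠ a) : ofVert K E b * J.pathElt K l w = 0 := by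
  rw [← h.ofVert_mul_pathElt K, ← mul_assoc]
  exact (congrArg (· * _) ((isCuntzKriegerFamily_gen K E).vert_orth b a hab)).trans (zero_mul _)

theorem Enters.ghost_mul_pathElt_cons {e : Ed} {l : List Ed} {w : W} (h : J.Enters (E.r e) l w) :
    gen K E (ghost e) * J.pathElt K (e :: l) w = J.pathElt K l w := by
  rw [pathElt_cons, ← mul_assoc, ofEdge, (isCuntzKriegerFamily_gen K E).ghost_edge_self]
  exact h.ofVert_mul_pathElt K

theorem ghost_mul_pathElt_cons_of_ne {e d : Ed} (hed : e ≠ d) (l : List Ed) (w : W) :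
    gen K E (ghost e) * J.pathElt K (d :: l) w = 0 := by
  rw [pathElt_cons, ← mul_assoc, ofEdge, (isCuntzKriegerFamily_gen K E).ghost_edge_ne e d hed,
    zero_mul]

variable (J) in
theorem star_pathElt_cons_mul (e : Ed) (l : List Ed) (w : W) (b : LeavittPathAlgebra K E) :
    star (J.pathElt K (e :: l) w) * b = star (J.pathElt K l w) * (gen K E (ghost e) * b) := by
  rw [pathElt_cons, star_mul, mul_assoc, ofEdge, star_gen]
  rfl

theorem Enters.star_pathElt_mul_self {a : V} {l : List Ed} {w : W} (h : J.Enters a l w) :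
    star (J.pathElt K l w) * J.pathElt K l w = ofVert K E (J.vertMap w) := by
  induction h with
  | nil w =>
    rw [star_pathElt_nil]
    exact (isCuntzKriegerFamily_gen K E).vert_idem _
  | cons _ h ih => rw [star_pathElt_cons_mul, h.ghost_mul_pathElt_cons K, ih]

theorem ofVert_mul_pathElt_cons {a : V} {e : Ed} {l : List Ed} {w : W}
    (h : J.Enters a (e :: l) w) (w' : W) :
    ofVert K E (J.vertMap w') * J.pathElt K (e :: l) w = 0 := by
  refine h.ofVert_mul_pathElt_of_ne K fun ha => ?_
  cases h with
  | cons he _ => exact he ⟨w', ha⟩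

theorem Enters.star_pathElt_mul_of_ne {a b : V} {l l' : List Ed} {w w' : W} (h : J.Enters a l w)
    (h' : J.Enters b l' w') (hl : l ≠ l') :
    star (J.pathElt K l w) * J.pathElt K l' w' = 0 := by
  induction h generalizing b l' with
  | nil w =>
    cases l' with
    | nil => exact absurd rfl hl
    | cons e l' =>
      rw [star_pathElt_nil]
      exact ofVert_mul_pathElt_cons K h' w
  | @cons e l w he h ih =>
    rw [star_pathElt_cons_mul]
    cases h' with
    | nil w' =>
      rw [← star_pathElt_cons_mul, ← star_inj, star_mul, star_star, star_zero, star_pathElt_nil]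
      exact ofVert_mul_pathElt_cons K (.cons he h) w'
    | @cons d l' _ hd h' =>
      by_cases hed : e = d
      · subst hed
        rw [h'.ghost_mul_pathElt_cons K, ih h' fun hll => hl (congrArg _ hll)]
      · rw [ghost_mul_pathElt_cons_of_ne K hed, mul_zero]

variable (J)

/-- The span of the elements `α b`, where `α` is a path that first enters `G` at its end and `b`
lies in the image of `L_K(G)`. -/
def pathSpan : Submodule K (LeavittPathAlgebra K E) :=
  Submodule.span K {z | ∃ a l w, J.Enters a l w ∧ ∃ b, z = J.pathElt K l w * J.hom K b}

variable {J K}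

theorem Enters.pathElt_mul_hom_mem_pathSpan {a : V} {l : List Ed} {w : W} (h : J.Enters a l w)
    (b : LeavittPathAlgebra K G) : J.pathElt K l w * J.hom K b ∈ J.pathSpan K :=
  Submodule.subset_span ⟨a, l, w, h, b, rfl⟩

theorem hom_mem_pathSpan (b : LeavittPathAlgebra K G) : J.hom K b ∈ J.pathSpan K := by
  suffices b ∈ (J.pathSpan K).comap (J.hom K : LeavittPathAlgebra K G →ₗ[K] _) from this
  refine mem_of_forall_ofVert_mul_mem fun w => ?_
  change J.hom K (gen K G (vert w) * b) ∈ J.pathSpan K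
  rw [map_mul, hom_gen]
  exact (Enters.nil w).pathElt_mul_hom_mem_pathSpan b

theorem gen_mapGen_mul_hom_mem_pathSpan (g : LeavittGen W D) (b : LeavittPathAlgebra K G) :
    gen K E (J.mapGen g) * J.hom K b ∈ J.pathSpan K := by
  rw [← hom_gen, ← map_mul]
  exact hom_mem_pathSpan _

theorem Enters.vert_mul_mem_pathSpan {a : V} {l : List Ed} {w : W} (h : J.Enters a l w) (c : V)
    (b : LeavittPathAlgebra K G) :
    gen K E (vert c) * (J.pathElt K l w * J.hom K b) ∈ J.pathSpan K := by
  rw [← mul_assoc, ← ofVert]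
  by_cases hc : c = a
  · rw [hc, h.ofVert_mul_pathElt K]
    exact h.pathElt_mul_hom_mem_pathSpan b
  · rw [h.ofVert_mul_pathElt_of_ne K hc, zero_mul]
    exact zero_mem _

theorem Enters.edge_mul_mem_pathSpan {a : V} {l : List Ed} {w : W} (h : J.Enters a l w) (e : Ed)
    (b : LeavittPathAlgebra K G) :
    gen K E (edge e) * (J.pathElt K l w * J.hom K b) ∈ J.pathSpan K := by
  by_cases hr : E.r e = a
  · by_cases he : E.s e ∈ Set.range J.vertMap
    · obtain ⟨d, rfl⟩ := J.mem_range_edgeMap e he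
      cases h with
      | nil w =>
        rw [pathElt_nil, ← map_mul]
        exact gen_mapGen_mul_hom_mem_pathSpan (edge d) _
      | cons ha _ => exact absurd (hr ▸ J.r_mem_range he) ha
    · rw [← mul_assoc, ← ofEdge, ← pathElt_cons]
      exact (Enters.cons he (hr ▸ h)).pathElt_mul_hom_mem_pathSpan b
  · rw [← (isCuntzKriegerFamily_gen K E).edge_range e, mul_assoc, ← mul_assoc (gen K E (vert _)),
      ← ofVert, h.ofVert_mul_pathElt_of_ne K hr, zero_mul, mul_zero]
    exact zero_mem _

theorem Enters.ghost_mul_mem_pathSpan {a : V} {l : List Ed} {w : W} (h : J.Enters a l w) (e : Ed)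
    (b : LeavittPathAlgebra K G) :
    gen K E (ghost e) * (J.pathElt K l w * J.hom K b) ∈ J.pathSpan K := by
  cases h with
  | nil w =>
    by_cases he : E.s e ∈ Set.range J.vertMap
    · obtain ⟨d, rfl⟩ := J.mem_range_edgeMap e he
      rw [pathElt_nil, ← map_mul]
      exact gen_mapGen_mul_hom_mem_pathSpan (ghost d) _
    · rw [← (isCuntzKriegerFamily_gen K E).ghost_source e, mul_assoc,
        ← mul_assoc (gen K E (vert _)), ← ofVert,
        (Enters.nil w).ofVert_mul_pathElt_of_ne K fun h => he ⟨w, h.symm⟩, zero_mul, mul_zero]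
      exact zero_mem _
  | @cons d l _ _ h =>
    rw [← mul_assoc]
    by_cases hed : e = d
    · rw [hed, h.ghost_mul_pathElt_cons K]
      exact h.pathElt_mul_hom_mem_pathSpan b
    · rw [ghost_mul_pathElt_cons_of_ne K hed, zero_mul]
      exact zero_mem _

theorem mul_mem_pathSpan (a : LeavittPathAlgebra K E) {z : LeavittPathAlgebra K E}
    (hz : z ∈ J.pathSpan K) : a * z ∈ J.pathSpan K := by
  have gen_mul_mem (g : LeavittGen V Ed) {z : LeavittPathAlgebra K E} (hz : z ∈ J.pathSpan K) :
      gen K E g * z ∈ J.pathSpan K := by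
    suffices J.pathSpan K ≤ (J.pathSpan K).comap (LinearMap.mulLeft K (gen K E g)) from this hz
    refine Submodule.span_le.2 ?_
    rintro _ ⟨_, _, _, h, b, rfl⟩
    cases g with
    | vert c => exact h.vert_mul_mem_pathSpan c b
    | edge e => exact h.edge_mul_mem_pathSpan e b
    | ghost e => exact h.ghost_mul_mem_pathSpan e b
  induction a using LeavittPathAlgebra.induction with
  | zero => exact (zero_mul z).symm ▸ zero_mem _
  | add a b ha hb => exact (add_mul a b z).symm ▸ add_mem ha hb
  | smul k a ha => exact (smul_mul_assoc k a z).symm ▸ Submodule.smul_mem _ k ha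
  | gen g => exact gen_mul_mem g hz
  | gen_mul g a ha => exact (mul_assoc (gen K E g) a z).symm ▸ gen_mul_mem g ha

section Corner

variable [Finite W]

theorem hom_one_mul_mem_range {z : LeavittPathAlgebra K E} (hz : z ∈ J.pathSpan K) :
    J.hom K 1 * z ∈ Set.range (J.hom K) := by
  suffices J.pathSpan K ≤
      (LinearMap.range (J.hom K : LeavittPathAlgebra K G →ₗ[K] LeavittPathAlgebra K E)).comap
        (LinearMap.mulLeft K (J.hom K 1)) from this hz
  refine Submodule.span_le.2 ?_
  rintro _ ⟨a, l, w, h, b, rfl⟩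
  cases l with
  | nil =>
    rw [pathElt_nil]
    exact ⟨1 * (gen K G (vert w) * b), (map_mul (J.hom K) _ _).trans
      (congrArg _ (map_mul (J.hom K) _ _))⟩
  | cons e l =>
    refine ⟨0, (map_zero (J.hom K)).trans (Eq.symm ?_)⟩
    have hone : J.hom K 1 * J.pathElt K (e :: l) w = 0 := by
      rw [one_def, vertexSum, map_sum, Finset.sum_mul]
      exact Finset.sum_eq_zero fun w' _ => by
        rw [ofVert, hom_gen]
        exact ofVert_mul_pathElt_cons K h w'
    exact (mul_assoc _ _ _).symm.trans (hone.symm ▸ zero_mul _)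

variable (J K)

theorem hom_one_mul_mul_hom_one_mem_range (b : LeavittPathAlgebra K E) :
    J.hom K 1 * b * J.hom K 1 ∈ Set.range (J.hom K) := by
  rw [mul_assoc]
  exact hom_one_mul_mem_range (mul_mem_pathSpan b (hom_mem_pathSpan 1))

theorem isFullCorner_hom (hfull : AddSubgroup.closure {z | ∃ a c, z = a * J.hom K 1 * c} = ⊤) :
    IsFullCorner (J.hom K : LeavittPathAlgebra K G →ₙ+* LeavittPathAlgebra K E) where
  injective := J.hom_injective K
  corner_mem_range := J.hom_one_mul_mul_hom_one_mem_range K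
  closure_eq_top := hfull

end Corner

end DirectedGraph.HereditaryEmbedding

namespace DirectedGraph

open LeavittPathAlgebra

section Hedgehog

variable {W D ι : Type*} (G : DirectedGraph W D) (r : ι → W)

/-- The graph obtained from `G` by adding, for every `i : ι`, a new vertex and a single edge from
it to `r i`. -/
def hedgehog : DirectedGraph (W ⊕ ι) (D ⊕ ι) where
  s := Sum.map G.s id
  r := Sum.elim (Sum.inl ∘ G.r) (Sum.inl ∘ r)

/-- The inclusion of `G` in its hedgehog graph. -/
def hedgehogEmbedding : G.HereditaryEmbedding (G.hedgehog r) where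
  vertMap := Sum.inl
  edgeMap := Sum.inl
  vertMap_injective := Sum.inl_injective
  edgeMap_injective := Sum.inl_injective
  s_edgeMap _ := rfl
  r_edgeMap _ := rfl
  mem_range_edgeMap
    | .inl d, _ => ⟨d, rfl⟩
    | .inr _, ⟨_, h⟩ => nomatch h

theorem hedgehog_s_preimage_inr (i : ι) : (G.hedgehog r).s ⁻¹' {Sum.inr i} = {Sum.inr i} := by
  ext (d | j)
  · exact iff_of_false nofun nofun
  · exact (Sum.inr_injective.eq_iff (a := j)).trans Sum.inr_injective.eq_iff.symm

theorem sum_hedgehog_s_preimage_inr {A : Type*} [AddCommMonoid A] {i : ι}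
    (h : ((G.hedgehog r).s ⁻¹' {Sum.inr i}).Finite) (f : D ⊕ ι → A) :
    ∑ e ∈ h.toFinset, f e = f (Sum.inr i) := by
  rw [← Finset.sum_singleton f]
  refine Finset.sum_congr ?_ fun _ _ => rfl
  rw [← Finset.coe_inj, h.coe_toFinset, hedgehog_s_preimage_inr, Finset.coe_singleton]

variable {A : Type*} [NonUnitalRing A] [StarRing A]

/-- The extension of a family `f`, indexed by the generating symbols of `G`, to those of the
hedgehog graph, in which the new edges are sent to `p`. -/
def hedgehogFamily (f : LeavittGen W D → A) (p : ι → A) : LeavittGen (W ⊕ ι) (D ⊕ ι) → A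
  | vert (.inl w) => f (vert w)
  | vert (.inr i) => p i * star (p i)
  | edge (.inl d) => f (edge d)
  | edge (.inr i) => p i
  | ghost (.inl d) => f (ghost d)
  | ghost (.inr i) => star (p i)

theorem hedgehogFamily_adjoint {f : LeavittGen W D → A} (hstar : ∀ g, f g.adjoint = star (f g))
    (p : ι → A) : ∀ g, hedgehogFamily f p g.adjoint = star (hedgehogFamily f p g)
  | vert (.inl w) => hstar (vert w)
  | edge (.inl d) => hstar (edge d)
  | ghost (.inl d) => hstar (ghost d)
  | vert (.inr i) => by simp only [LeavittGen.adjoint, hedgehogFamily, star_mul, star_star]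
  | edge (.inr i) => rfl
  | ghost (.inr i) => (star_star _).symm

section CuntzKrieger

variable {f : LeavittGen W D → A} {p : ι → A}

theorem hedgehogFamily_vert_mul_vert_of_ne (hf : IsCuntzKriegerFamily G f)
    (hne : ∀ i j, i ≠ j → star (p i) * p j = 0) (hfp : ∀ w i, f (vert w) * p i = 0)
    (hpf : ∀ i w, star (p i) * f (vert w) = 0) : ∀ a b : W ⊕ ι, a ≠ b →
      hedgehogFamily f p (vert a) * hedgehogFamily f p (vert b) = 0
  | .inl w, .inl w', h => hf.vert_orth w w' fun hw => h (congrArg _ hw)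
  | .inl w, .inr i, _ => by simp only [hedgehogFamily, ← mul_assoc, hfp, zero_mul]
  | .inr i, .inl w, _ => by simp only [hedgehogFamily, mul_assoc, hpf, mul_zero]
  | .inr i, .inr j, h => by
    simp only [hedgehogFamily]
    rw [mul_assoc, ← mul_assoc (star (p i)), hne i j fun hij => h (congrArg _ hij), zero_mul,
      mul_zero]

theorem hedgehogFamily_ghost_mul_edge_of_ne (hf : IsCuntzKriegerFamily G f)
    (hne : ∀ i j, i ≠ j → star (p i) * p j = 0) (hfp : ∀ w i, f (vert w) * p i = 0)
    (hpf : ∀ i w, star (p i) * f (vert w) = 0) : ∀ e d : D ⊕ ι, e ≠ d →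
      hedgehogFamily f p (ghost e) * hedgehogFamily f p (edge d) = 0
  | .inl d, .inl d', h => hf.ghost_edge_ne d d' fun hd => h (congrArg _ hd)
  | .inl d, .inr i, _ => by
    simp only [hedgehogFamily]
    rw [← hf.ghost_source, mul_assoc, hfp, mul_zero]
  | .inr i, .inl d, _ => by
    simp only [hedgehogFamily]
    rw [← hf.source_edge, ← mul_assoc, hpf, zero_mul]
  | .inr i, .inr j, h => hne i j fun hij => h (congrArg _ hij)

theorem hedgehogFamily_vert_eq_sum (hf : IsCuntzKriegerFamily G f) :
    ∀ (a : W ⊕ ι) (hfin : ((G.hedgehog r).s ⁻¹' {a}).Finite),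
      ((G.hedgehog r).s ⁻¹' {a}).Nonempty → hedgehogFamily f p (vert a) =
        ∑ e ∈ hfin.toFinset, hedgehogFamily f p (edge e) * hedgehogFamily f p (ghost e)
  | .inl w, hfin, hne => by
    have himage := (G.hedgehogEmbedding r).s_preimage_vertMap w
    have hfin' : (G.s ⁻¹' {w}).Finite :=
      Set.Finite.of_finite_image (himage ▸ hfin) Sum.inl_injective.injOn
    exact (hf.regular_vert w hfin' (Set.image_nonempty.1 (himage ▸ hne))).trans
      ((G.hedgehogEmbedding r).sum_s_preimage hfin' hfin
        fun e => hedgehogFamily f p (edge e) * hedgehogFamily f p (ghost e)).symm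
  | .inr _, hfin, _ => (G.sum_hedgehog_s_preimage_inr r hfin
      fun e => hedgehogFamily f p (edge e) * hedgehogFamily f p (ghost e)).symm

theorem isCuntzKriegerFamily_hedgehogFamily (hf : IsCuntzKriegerFamily G f)
    (hstar : ∀ g, f g.adjoint = star (f g)) (hpr : ∀ i, p i * f (vert (r i)) = p i)
    (hpp : ∀ i, star (p i) * p i = f (vert (r i)))
    (hne : ∀ i j, i ≠ j → star (p i) * p j = 0) (hfp : ∀ w i, f (vert w) * p i = 0) :
    IsCuntzKriegerFamily (G.hedgehog r) (hedgehogFamily f p) := by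
  have star_vert (w : W) : star (f (vert w)) = f (vert w) := (hstar (vert w)).symm
  have vert_star (i : ι) : f (vert (r i)) * star (p i) = star (p i) := by
    rw [← star_vert, ← star_mul, hpr]
  have star_mul_vert (i : ι) (w : W) : star (p i) * f (vert w) = 0 := by
    rw [← star_vert, ← star_mul, hfp, star_zero]
  have mul_star_mul (i : ι) : p i * star (p i) * p i = p i := by rw [mul_assoc, hpp, hpr]
  exact
  { vert_idem
      | .inl w => hf.vert_idem w
      | .inr i => by simp only [hedgehogFamily, ← mul_assoc, mul_star_mul]
    vert_orth := G.hedgehogFamily_vert_mul_vert_of_ne hf hne hfp star_mul_vert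
    source_edge
      | .inl d => hf.source_edge d
      | .inr i => mul_star_mul i
    edge_range
      | .inl d => hf.edge_range d
      | .inr i => hpr i
    range_ghost
      | .inl d => hf.range_ghost d
      | .inr i => vert_star i
    ghost_source
      | .inl d => hf.ghost_source d
      | .inr i => (mul_assoc _ _ _).symm.trans ((congrArg (· * _) (hpp i)).trans (vert_star i))
    ghost_edge_self
      | .inl d => hf.ghost_edge_self d
      | .inr i => hpp i
    ghost_edge_ne := G.hedgehogFamily_ghost_mul_edge_of_ne hf hne hfp star_mul_vert
    regular_vert := G.hedgehogFamily_vert_eq_sum r hf }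

end CuntzKrieger

end Hedgehog

end DirectedGraph

namespace LeavittPathAlgebra

variable {K : Type*} [Field K] {V Ed : Type*} {E : DirectedGraph V Ed}

theorem closure_mul_mul_eq_top {e : LeavittPathAlgebra K E}
    (he : ∀ a, ∃ x y, ofVert K E a = x * e * y) :
    AddSubgroup.closure {z | ∃ x y, z = x * e * y} = ⊤ := by
  refine top_unique fun b _ => mem_of_forall_ofVert_mul_mem fun a => ?_
  obtain ⟨x, y, h⟩ := he a
  exact AddSubgroup.subset_closure ⟨x, y * b, by rw [h, mul_assoc]⟩

end LeavittPathAlgebra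

namespace DirectedGraph

open LeavittPathAlgebra

theorem isFullCorner_hedgehogEmbedding_hom (K : Type*) [Field K] {W D ι : Type*} [Finite W]
    (G : DirectedGraph W D) (r : ι → W) : IsFullCorner
      ((G.hedgehogEmbedding r).hom K : LeavittPathAlgebra K G →ₙ+*
        LeavittPathAlgebra K (G.hedgehog r)) := by
  refine (G.hedgehogEmbedding r).isFullCorner_hom K (closure_mul_mul_eq_top ?_)
  have one_mul_vert (w : W) : (G.hedgehogEmbedding r).hom K 1 * ofVert K _ (.inl w) =
      ofVert K _ (.inl w) := by
    change _ * gen K _ ((G.hedgehogEmbedding r).mapGen (vert w)) = _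
    rw [← HereditaryEmbedding.hom_gen, ← map_mul, one_mul]
    exact HereditaryEmbedding.hom_gen _ K _
  have family := isCuntzKriegerFamily_gen K (G.hedgehog r)
  rintro (w | i)
  · refine ⟨ofVert K _ (.inl w), ofVert K _ (.inl w), ?_⟩
    rw [mul_assoc, one_mul_vert]
    exact (family.vert_idem _).symm
  · refine ⟨gen K _ (edge (.inr i)), gen K _ (vert (.inl (r i))) * gen K _ (ghost (.inr i)), ?_⟩
    have hfin : ((G.hedgehog r).s ⁻¹' {Sum.inr i}).Finite :=
      (G.hedgehog_s_preimage_inr r i).symm ▸ Set.finite_singleton _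
    rw [mul_assoc, ← mul_assoc (HereditaryEmbedding.hom _ K 1), ← ofVert, one_mul_vert, ofVert,
      ofVert, family.regular_vert _ hfin ⟨.inr i, rfl⟩, sum_hedgehog_s_preimage_inr]
    exact congrArg _ (family.range_ghost (.inr i)).symm

end DirectedGraph

theorem mem_span_singleton_iff_mem_closure {R : Type*} [Ring R] {e z : R} :
    z ∈ TwoSidedIdeal.span {e} ↔ z ∈ AddSubgroup.closure {z | ∃ a c, z = a * e * c} := by
  rw [TwoSidedIdeal.mem_span_iff_mem_addSubgroup_closure]
  refine iff_of_eq (congrArg (fun s => z ∈ AddSubgroup.closure s) (Set.ext fun y => ?_))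
  constructor
  · rintro ⟨_, ⟨a, -, _, rfl, rfl⟩, c, -, rfl⟩
    exact ⟨a, c, rfl⟩
  · rintro ⟨a, c, rfl⟩
    exact ⟨_, ⟨a, trivial, e, rfl, rfl⟩, c, trivial, rfl⟩

namespace DirectedGraph.HereditaryEmbedding

open LeavittPathAlgebra

variable {W : Type*} {V : Type*} {D : Type*} {Ed : Type*} {G : DirectedGraph W D}
  {E : DirectedGraph V Ed} (J : G.HereditaryEmbedding E)

/-- The paths of positive length that meet the vertices of `G` at their end only. Such a path is
encoded by its first edge and the list of the remaining ones. -/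
def EntryPath : Type _ := {p : Ed × List Ed // ∃ w, J.Enters (E.s p.1) (p.1 :: p.2) w}

namespace EntryPath

variable {J}

/-- The list of edges of an entry path. -/
def edges (α : J.EntryPath) : List Ed := α.1.1 :: α.1.2

/-- The vertex of `G` at which an entry path ends. -/
def range (α : J.EntryPath) : W := α.2.choose

theorem enters (α : J.EntryPath) : J.Enters (E.s α.1.1) α.edges α.range := α.2.choose_spec

theorem edges_injective : Function.Injective (edges (J := J)) := fun _ _ h =>
  Subtype.ext (Prod.ext (List.cons.inj h).1 (List.cons.inj h).2)

end EntryPath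

variable (K : Type*) [Field K]

/-- The homomorphism from the Leavitt path algebra of the hedgehog graph of `G` in `E`, whose new
edges are the entry paths, that extends `J.hom K` and sends every new edge to the corresponding
path. -/
def hedgehogHom :
    LeavittPathAlgebra K (G.hedgehog (EntryPath.range (J := J))) →ₙₐ[K] LeavittPathAlgebra K E :=
  lift K (hedgehogFamily (gen K E ∘ J.mapGen) fun α => J.pathElt K α.edges α.range) <|
    G.isCuntzKriegerFamily_hedgehogFamily _
      (J.isCuntzKriegerFamily_comp_mapGen (isCuntzKriegerFamily_gen K E))
      (fun g => by rw [Function.comp_apply, Function.comp_apply, star_gen, mapGen, adjoint_map])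
      (fun α => J.pathElt_mul_ofVert K _ _)
      (fun α => α.enters.star_pathElt_mul_self K)
      (fun α β h => α.enters.star_pathElt_mul_of_ne K β.enters (EntryPath.edges_injective.ne h))
      (fun w α => ofVert_mul_pathElt_cons K α.enters w)

theorem hedgehogHom_edge_inr (α : J.EntryPath) :
    J.hedgehogHom K (gen K _ (edge (.inr α))) = J.pathElt K α.edges α.range :=
  lift_gen K _ _ _

theorem hedgehogHom_comp_hom :
    (J.hedgehogHom K).comp ((G.hedgehogEmbedding EntryPath.range).hom K) = J.hom K :=
  LeavittPathAlgebra.hom_ext fun g => by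
    rw [NonUnitalAlgHom.comp_apply, hom_gen, hom_gen]
    exact (lift_gen K _ _ _).trans (by cases g <;> rfl)

theorem hedgehogHom_hom (b : LeavittPathAlgebra K G) :
    J.hedgehogHom K ((G.hedgehogEmbedding EntryPath.range).hom K b) = J.hom K b :=
  DFunLike.congr_fun (J.hedgehogHom_comp_hom K) b

theorem hedgehogHom_star (a : LeavittPathAlgebra K (G.hedgehog (EntryPath.range (J := J)))) :
    J.hedgehogHom K (star a) = star (J.hedgehogHom K a) :=
  map_star_of_map_gen_adjoint (fun g => by
    rw [hedgehogHom, lift_gen, lift_gen]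
    exact hedgehogFamily_adjoint
      (fun g => by rw [Function.comp_apply, Function.comp_apply, star_gen, mapGen, adjoint_map])
      _ g) a

theorem hedgehogHom_injective [Finite W] : Function.Injective (J.hedgehogHom K) :=
  (G.isFullCorner_hedgehogEmbedding_hom K EntryPath.range).injective_of_injective_comp
    hasLeftLocalUnits exists_mul_eq_self
    (ψ := (J.hedgehogHom K : LeavittPathAlgebra K (G.hedgehog (EntryPath.range (J := J))) →ₙ+*
      LeavittPathAlgebra K E)) fun a b h =>
      J.hom_injective K <|
        (J.hedgehogHom_hom K a).symm.trans (h.trans (J.hedgehogHom_hom K b))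

variable {K}

theorem mem_range_hedgehogHom_of_mem_pathSpan {z : LeavittPathAlgebra K E}
    (hz : z ∈ J.pathSpan K) : z ∈ NonUnitalAlgHom.range (J.hedgehogHom K) := by
  have hom_mem (b : LeavittPathAlgebra K G) :
      J.hom K b ∈ NonUnitalAlgHom.range (J.hedgehogHom K) := ⟨_, J.hedgehogHom_hom K b⟩
  suffices J.pathSpan K ≤ (NonUnitalAlgHom.range (J.hedgehogHom K)).toSubmodule from this hz
  refine Submodule.span_le.2 ?_
  rintro _ ⟨a, l, w, h, b, rfl⟩
  suffices hl : J.pathElt K l w ∈ NonUnitalAlgHom.range (J.hedgehogHom K) from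
    (NonUnitalAlgHom.range (J.hedgehogHom K)).mul_mem' hl (hom_mem b)
  cases h with
  | nil w => exact J.pathElt_nil K w ▸ hom_mem _
  | @cons e l w he h =>
    have entry := Enters.cons he h
    let α : J.EntryPath := ⟨(e, l), w, entry⟩
    exact (NonUnitalAlgHom.mem_range _).2 ⟨_, (J.hedgehogHom_edge_inr K α).trans <|
      congrArg (J.pathElt K (e :: l)) (α.enters.unique entry)⟩

theorem hedgehogHom_mem_span [Finite W]
    (z : LeavittPathAlgebra K (G.hedgehog (EntryPath.range (J := J)))) :
    J.hedgehogHom K z ∈ TwoSidedIdeal.span {J.hom K 1} := by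
  have hz : z ∈ AddSubgroup.closure _ :=
    (G.isFullCorner_hedgehogEmbedding_hom K EntryPath.range).closure_eq_top ▸
      AddSubgroup.mem_top z
  induction hz using AddSubgroup.closure_induction with
  | mem z hz =>
    obtain ⟨a, c, rfl⟩ := hz
    rw [map_mul, map_mul]
    refine TwoSidedIdeal.mul_mem_right _ _ _ (TwoSidedIdeal.mul_mem_left _ _ _ ?_)
    exact TwoSidedIdeal.subset_span (J.hedgehogHom_hom K 1)
  | zero => exact (map_zero (J.hedgehogHom K)).symm ▸ TwoSidedIdeal.zero_mem _
  | add a b _ _ ha hb =>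
    exact (map_add (J.hedgehogHom K) a b).symm ▸ TwoSidedIdeal.add_mem _ ha hb
  | neg a _ ha => exact (map_neg (J.hedgehogHom K) a).symm ▸ TwoSidedIdeal.neg_mem _ ha

theorem mul_hom_one_mul_mem_range_hedgehogHom [Finite W] (x y : LeavittPathAlgebra K E) :
    x * J.hom K 1 * y ∈ NonUnitalAlgHom.range (J.hedgehogHom K) := by
  have mul_hom_one_mem (x : LeavittPathAlgebra K E) :
      x * J.hom K 1 ∈ NonUnitalAlgHom.range (J.hedgehogHom K) :=
    J.mem_range_hedgehogHom_of_mem_pathSpan (mul_mem_pathSpan x (hom_mem_pathSpan 1))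
  have hom_one_mul_mem : J.hom K 1 * y ∈ NonUnitalAlgHom.range (J.hedgehogHom K) := by
    obtain ⟨b, hb⟩ := mul_hom_one_mem (star y)
    refine ⟨star b, (J.hedgehogHom_star K b).trans ?_⟩
    rw [show J.hedgehogHom K b = _ from hb, star_mul, star_star, ← hom_star, star_one]
  have hone : J.hom K 1 = J.hom K 1 * J.hom K 1 := by rw [← map_mul, one_mul]
  rw [hone, ← mul_assoc, mul_assoc]
  exact mul_mem (mul_hom_one_mem x) hom_one_mul_mem

theorem range_hedgehogHom [Finite V] [Finite W] :
    Set.range (J.hedgehogHom K) = TwoSidedIdeal.span {J.hom K 1} := by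
  refine Set.Subset.antisymm (Set.range_subset_iff.2 J.hedgehogHom_mem_span) fun z hz => ?_
  suffices z ∈ (NonUnitalAlgHom.range (J.hedgehogHom K)).toSubmodule.toAddSubgroup from this
  refine (AddSubgroup.closure_le _).2 ?_ (mem_span_singleton_iff_mem_closure.1 hz)
  rintro _ ⟨x, y, rfl⟩
  exact J.mul_hom_one_mul_mem_range_hedgehogHom x y

end DirectedGraph.HereditaryEmbedding

namespace LeavittPathAlgebra

section VertexIdeal

variable (K : Type u) [Field K] {V : Type v} {Ed : Type w} [Finite V] {E : DirectedGraph V Ed}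
  {H : Set V} (hH : E.Hereditary H)

theorem range_hedgehogHom_embedding :
    Set.range (hH.embedding.hedgehogHom K) = vertexIdealAlgebra K E H := by
  rw [DirectedGraph.HereditaryEmbedding.range_hedgehogHom, ← restrictHom_eq_hom, restrictHom_one]
  rfl

/-- The isomorphism from the Leavitt path algebra of the hedgehog graph of `E_H` in `E` onto the
ideal generated by the vertices in `H`. -/
def hedgehogToVertexIdeal :
    LeavittPathAlgebra K ((E.restrict H hH).hedgehog
      (DirectedGraph.HereditaryEmbedding.EntryPath.range (J := hH.embedding))) →ₙₐ[K]
      vertexIdealAlgebra K E H :=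
  NonUnitalAlgHom.codRestrict (hH.embedding.hedgehogHom K) _ fun z =>
    (range_hedgehogHom_embedding K hH).le ⟨z, rfl⟩

theorem bijective_hedgehogToVertexIdeal : Function.Bijective (hedgehogToVertexIdeal K hH) := by
  refine ⟨fun a b h => hH.embedding.hedgehogHom_injective K (congrArg Subtype.val h), ?_⟩
  rintro ⟨z, hz⟩
  obtain ⟨a, ha⟩ := (range_hedgehogHom_embedding K hH).ge hz
  exact ⟨a, Subtype.ext ha⟩

theorem hasLeftLocalUnits_vertexIdealAlgebra (hH : E.Hereditary H) :
    HasLeftLocalUnits (vertexIdealAlgebra K E H) :=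
  hasLeftLocalUnits.of_bijective (bijective_hedgehogToVertexIdeal K hH)

theorem nonempty_unitaryModuleCat_equivalence :
    Nonempty (UnitaryModuleCat.{max u v w, max u v w} (vertexIdealAlgebra K E H) ≌
      ModuleCat.{max u v w} (LeavittPathAlgebra K (E.restrict H hH))) :=
  have fullCorner := (DirectedGraph.isFullCorner_hedgehogEmbedding_hom K (E.restrict H hH)
    DirectedGraph.HereditaryEmbedding.EntryPath.range).comp_of_bijective
      (bijective_hedgehogToVertexIdeal K hH)
  UnitaryModuleCat.nonempty_equivalence_of_isFullCorner fullCorner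
    (hasLeftLocalUnits_vertexIdealAlgebra K hH)

end VertexIdeal

end LeavittPathAlgebra

namespace LeavittPathAlgebra

section LeftIdeals

variable {K : Type u} [Field K] {V : Type v} {Ed : Type w} [Finite V] {E : DirectedGraph V Ed}
  {H : Set V}

theorem mem_vertexIdeal_of_mem_vertexSumIdeal {z : LeavittPathAlgebra K E}
    (hz : z ∈ vertexSumIdeal K E H) : z ∈ vertexIdeal K E H := by
  obtain ⟨y, hy, rfl⟩ := hz
  exact (vertexIdeal K E H).mul_mem_left _ _ hy

theorem vertexSum_mul_of_mem_vertexSumIdeal {z : LeavittPathAlgebra K E}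
    (hz : z ∈ vertexSumIdeal K E H) : vertexSum K E H * z = z := by
  obtain ⟨y, -, rfl⟩ := hz
  rw [← mul_assoc, vertexSum_mul_self]

variable (hH : E.Hereditary H)

/-- The submodule `J ∩ ρI` of `ρI`, for a left ideal `J`. -/
def vertexSumIdealInter (J : Ideal (LeavittPathAlgebra K E)) :
    Submodule (LeavittPathAlgebra K (E.restrict H hH)) (vertexSumIdeal K E H) where
  carrier := {z | z.1 ∈ J}
  add_mem' := J.add_mem
  zero_mem' := J.zero_mem
  smul_mem' a _ hz := J.mul_mem_left (restrictHom K hH a) hz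

variable {hH}

/-- The left ideal `L_K(E) N`, for a submodule `N` of `ρI`. -/
def spanVertexSumIdeal
    (N : Submodule (LeavittPathAlgebra K (E.restrict H hH)) (vertexSumIdeal K E H)) :
    Ideal (LeavittPathAlgebra K E) :=
  Ideal.span (Subtype.val '' (N : Set (vertexSumIdeal K E H)))

theorem spanVertexSumIdeal_le_iff {J : Ideal (LeavittPathAlgebra K E)}
    {N : Submodule (LeavittPathAlgebra K (E.restrict H hH)) (vertexSumIdeal K E H)} :
    spanVertexSumIdeal N ≤ J ↔ N ≤ vertexSumIdealInter hH J :=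
  Ideal.span_le.trans Set.image_subset_iff

theorem spanVertexSumIdeal_le_vertexIdeal
    (N : Submodule (LeavittPathAlgebra K (E.restrict H hH)) (vertexSumIdeal K E H)) :
    spanVertexSumIdeal N ≤ (vertexIdeal K E H).asIdeal :=
  spanVertexSumIdeal_le_iff.2 fun z _ => mem_vertexIdeal_of_mem_vertexSumIdeal z.2

theorem spanVertexSumIdeal_vertexSumIdealInter {J : Ideal (LeavittPathAlgebra K E)}
    (hJ : J ≤ (vertexIdeal K E H).asIdeal) :
    spanVertexSumIdeal (vertexSumIdealInter hH J) = J := by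
  refine le_antisymm (spanVertexSumIdeal_le_iff.2 le_rfl) fun j hj => ?_
  obtain ⟨⟨u, hu⟩, huj⟩ :=
    (hasLeftLocalUnits_vertexIdealAlgebra K hH).exists_mul_eq_self ⟨j, hJ hj⟩
  rw [← show u * j = j from congrArg Subtype.val huj]
  suffices AddSubgroup.closure {z | ∃ a c, z = a * vertexSum K E H * c} ≤
      (spanVertexSumIdeal (vertexSumIdealInter hH J)).toAddSubgroup.comap
        (AddMonoidHom.mulRight j) from
    this (mem_span_singleton_iff_mem_closure.1 hu)
  refine (AddSubgroup.closure_le _).2 ?_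
  rintro _ ⟨a, c, rfl⟩
  have hcj : vertexSum K E H * (c * j) ∈ vertexSumIdeal K E H :=
    ⟨c * j, hJ (J.mul_mem_left c hj), rfl⟩
  change a * vertexSum K E H * c * j ∈ spanVertexSumIdeal _
  rw [mul_assoc, mul_assoc]
  exact Ideal.mul_mem_left _ _ <|
    Ideal.subset_span ⟨⟨_, hcj⟩, J.mul_mem_left _ (J.mul_mem_left c hj), rfl⟩

theorem exists_vertexSum_mul_eq_of_mem_spanVertexSumIdeal
    {N : Submodule (LeavittPathAlgebra K (E.restrict H hH)) (vertexSumIdeal K E H)}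
    {z : LeavittPathAlgebra K E} (hz : z ∈ spanVertexSumIdeal N) :
    ∃ n ∈ N, vertexSum K E H * z = n.1 := by
  induction hz using Submodule.closure_induction with
  | zero => exact ⟨0, N.zero_mem, mul_zero _⟩
  | add x y _ _ hx hy =>
    obtain ⟨m, hm, hxm⟩ := hx
    obtain ⟨n, hn, hyn⟩ := hy
    exact ⟨m + n, N.add_mem hm hn, (mul_add _ _ _).trans (congrArg₂ _ hxm hyn)⟩
  | smul_mem b _ hy =>
    obtain ⟨n, hn, rfl⟩ := hy
    obtain ⟨a, ha⟩ := hH.embedding.hom_one_mul_mul_hom_one_mem_range K b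
    rw [← restrictHom_eq_hom, restrictHom_one] at ha
    refine ⟨a • n, N.smul_mem a hn, ?_⟩
    change vertexSum K E H * (b * n.1) = restrictHom K hH a * n.1
    rw [ha, mul_assoc, vertexSum_mul_of_mem_vertexSumIdeal n.2, mul_assoc]

theorem vertexSumIdealInter_spanVertexSumIdeal
    (N : Submodule (LeavittPathAlgebra K (E.restrict H hH)) (vertexSumIdeal K E H)) :
    vertexSumIdealInter hH (spanVertexSumIdeal N) = N := by
  refine le_antisymm (fun z hz => ?_) (spanVertexSumIdeal_le_iff.1 le_rfl)
  obtain ⟨n, hn, h⟩ := exists_vertexSum_mul_eq_of_mem_spanVertexSumIdeal hz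
  rw [vertexSum_mul_of_mem_vertexSumIdeal z.2] at h
  exact Subtype.ext h ▸ hn

variable (K hH)

/-- The isomorphism `J ↦ J ∩ ρI` between the lattice of left ideals contained in `I` and the
lattice of `L_K(E_H)`-submodules of `ρI`. -/
def leftIdealOrderIso :
    {J : Ideal (LeavittPathAlgebra K E) // J ≤ (vertexIdeal K E H).asIdeal} ≃o
      Submodule (LeavittPathAlgebra K (E.restrict H hH)) (vertexSumIdeal K E H) where
  toFun J := vertexSumIdealInter hH J.1
  invFun N := ⟨spanVertexSumIdeal N, spanVertexSumIdeal_le_vertexIdeal N⟩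
  left_inv J := Subtype.ext (spanVertexSumIdeal_vertexSumIdealInter J.2)
  right_inv := vertexSumIdealInter_spanVertexSumIdeal
  map_rel_iff' {J J'} := by
    change vertexSumIdealInter hH J.1 ≤ vertexSumIdealInter hH J'.1 ↔ J.1 ≤ J'.1
    rw [← spanVertexSumIdeal_le_iff, spanVertexSumIdeal_vertexSumIdealInter J.2]

end LeftIdeals

end LeavittPathAlgebra

section PolynomialGenerators

open Polynomial

variable {K : Type*} [Field K]

theorem exists_eq_span_singleton_eval_zero_eq_one {P : Ideal K[X]} (hP : P ≠ ⊥)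
    (hX : ∀ p, X * p ∈ P → p ∈ P) : ∃ q : K[X], q.eval 0 = 1 ∧ P = Ideal.span {q} := by
  obtain ⟨q, rfl⟩ : ∃ q, P = Ideal.span {q} := (IsPrincipalIdealRing.principal P).principal
  have hq : q ≠ 0 := fun h => hP (Ideal.span_singleton_eq_bot.2 h)
  have hq0 : q.eval 0 ≠ 0 := by
    rw [← coeff_zero_eq_eval_zero]
    intro h
    obtain ⟨p, rfl⟩ := X_dvd_iff.2 h
    have hdvd : X * p ∣ 1 * p := by
      rw [one_mul]
      exact Ideal.mem_span_singleton.1 (hX p (Ideal.mem_span_singleton_self _))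
    exact not_isUnit_X <| isUnit_of_dvd_one <|
      (mul_dvd_mul_iff_right (right_ne_zero_of_mul hq)).1 hdvd
  refine ⟨q * C (q.eval 0)⁻¹, by rw [eval_mul, eval_C, mul_inv_cancel₀ hq0], ?_⟩
  exact (Ideal.span_singleton_mul_right_unit (isUnit_C.2 (inv_ne_zero hq0).isUnit) q).symm

variable {A : Type*} [Ring A] [Algebra K A] {t : A}

theorem mem_span_aeval_of_mul_pow_eq_zero {p : K[X]} (hp : p.eval 0 = 1) {z : A} {n : ℕ}
    (hz : z * t ^ n = 0) : z ∈ Ideal.span {aeval t p} := by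
  have hcop : IsCoprime p (X ^ n) := by
    refine IsCoprime.pow_right ((irreducible_X.coprime_iff_not_dvd.2 fun h => ?_).symm)
    rw [X_dvd_iff, coeff_zero_eq_eval_zero, hp] at h
    exact one_ne_zero h
  obtain ⟨a, b, hab⟩ := hcop
  refine Ideal.mem_span_singleton'.2 ⟨z * aeval t a, ?_⟩
  calc z * aeval t a * aeval t p
      = z * aeval t (a * p + X ^ n * b) := by
        rw [map_add, map_mul, map_mul, map_pow, aeval_X, mul_add, ← mul_assoc, ← mul_assoc, hz,
          zero_mul, add_zero]
    _ = z := by rw [mul_comm (X ^ n), hab, map_one, mul_one]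

theorem mem_of_pow_mul_mem {I : TwoSidedIdeal A} {s : A} (hst : s * t - 1 ∈ I) {J : Ideal A}
    (hJ : I.asIdeal ≤ J) {n : ℕ} {a : A} (ha : t ^ n * a ∈ J) : a ∈ J := by
  induction n generalizing a with
  | zero => simpa using ha
  | succ n ih =>
    have hta : t * a ∈ J := ih (by rwa [← mul_assoc, ← pow_succ])
    have ha : a = s * (t * a) - (s * t - 1) * a := by noncomm_ring
    rw [ha]
    exact sub_mem (J.mul_mem_left s hta) (hJ (I.mul_mem_right _ a hst))

/-- The hypotheses say that `t` becomes invertible modulo `I`, that `A / I` consists of Laurent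
polynomials in `t`, and that every element of `I` is killed by a power of `t`. -/
theorem exists_eq_span_aeval_of_lt {I : TwoSidedIdeal A} {s : A} (hst : s * t - 1 ∈ I)
    (hlaurent : ∀ a, ∃ (n : ℕ) (p : K[X]), t ^ n * a - aeval t p ∈ I)
    (htorsion : ∀ z ∈ I, ∃ n : ℕ, z * t ^ n = 0) {J : Ideal A} (hJ : I.asIdeal < J) :
    ∃ p : K[X], p.eval 0 = 1 ∧ J = Ideal.span {aeval t p} := by
  have aeval_mem {a : A} (ha : a ∈ J) {n : ℕ} {p : K[X]} (h : t ^ n * a - aeval t p ∈ I) :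
      aeval t p ∈ J :=
    (Submodule.sub_mem_iff_right J (J.mul_mem_left _ ha)).1 (hJ.le h)
  have comap_ne_bot : J.comap (aeval t : K[X] →ₐ[K] A) ≠ ⊥ := by
    intro hbot
    refine hJ.not_ge fun a ha => ?_
    obtain ⟨n, p, h⟩ := hlaurent a
    have hp : p = 0 := (Submodule.eq_bot_iff _).1 hbot p (aeval_mem ha h)
    rw [hp, map_zero, sub_zero] at h
    exact mem_of_pow_mul_mem hst le_rfl h
  obtain ⟨q, hq0, hq⟩ := exists_eq_span_singleton_eval_zero_eq_one comap_ne_bot fun p hp =>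
    mem_of_pow_mul_mem hst hJ.le (n := 1) (by simpa using hp)
  have I_le : I.asIdeal ≤ Ideal.span {aeval t q} := fun z hz =>
    have ⟨_, hn⟩ := htorsion z hz
    mem_span_aeval_of_mul_pow_eq_zero hq0 hn
  refine ⟨q, hq0, le_antisymm (fun a ha => ?_) ?_⟩
  · obtain ⟨n, p, h⟩ := hlaurent a
    obtain ⟨r, rfl⟩ : ∃ r, r * q = p := Ideal.mem_span_singleton'.1 (hq ▸ aeval_mem ha h)
    refine mem_of_pow_mul_mem hst I_le ((Submodule.sub_mem_iff_left _ ?_).1 (I_le h))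
    exact Ideal.mem_span_singleton'.2 ⟨_, (map_mul (aeval t) r q).symm⟩
  · have hqJ : q ∈ J.comap (aeval t : K[X] →ₐ[K] A) := hq ▸ Ideal.mem_span_singleton_self q
    exact (Ideal.span_singleton_le_iff_mem J).2 hqJ

end PolynomialGenerators

namespace LeavittPathAlgebra

section SourceLoop

variable (K : Type u) [Field K] {V : Type v} {Ed : Type w} {E : DirectedGraph V Ed} {τ : Ed}

theorem ofVert_mul_ofEdge_of_ne {v : V} {e : Ed} (h : v ≠ E.s e) :
    ofVert K E v * ofEdge K E e = 0 := by
  rw [ofEdge, ← (isCuntzKriegerFamily_gen K E).source_edge, ← mul_assoc,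
    ofVert, (isCuntzKriegerFamily_gen K E).vert_orth _ _ h, zero_mul]

theorem ofEdge_mul_ofEdge_of_ne {e e' : Ed} (h : E.r e ≠ E.s e') :
    ofEdge K E e * ofEdge K E e' = 0 := by
  rw [ofEdge, ← (isCuntzKriegerFamily_gen K E).edge_range, mul_assoc, ← ofVert,
    ofVert_mul_ofEdge_of_ne K h, mul_zero]

variable [Finite V]

theorem ofVert_mem_vertexIdeal {H : Set V} {v : V} (hv : v ∈ H) :
    ofVert K E v ∈ vertexIdeal K E H := by
  rw [← ofVert_mul_vertexSum K E H hv]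
  exact (vertexIdeal K E H).mul_mem_left _ _ (TwoSidedIdeal.subset_span rfl)

theorem one_sub_ofVert_mem_vertexIdeal (v : V) :
    1 - ofVert K E v ∈ vertexIdeal K E {v}ᶜ := by
  classical
  have hv : v ∈ Set.univ.toFinite.toFinset := Set.univ.toFinite.mem_toFinset.2 (Set.mem_univ v)
  rw [one_def, vertexSum, ← Finset.add_sum_erase _ _ hv, add_sub_cancel_left]
  exact sum_mem fun w hw => ofVert_mem_vertexIdeal K (Finset.ne_of_mem_erase hw)

variable (hτ : E.IsSourceLoop τ)
include hτ

theorem ofEdge_mem_vertexIdeal {e : Ed} (he : e ≠ τ) :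
    ofEdge K E e ∈ vertexIdeal K E {E.s τ}ᶜ := by
  rw [ofEdge, ← (isCuntzKriegerFamily_gen K E).edge_range]
  exact (vertexIdeal K E _).mul_mem_left _ _ (ofVert_mem_vertexIdeal K fun h => he (hτ.2 e h))

theorem ghost_mem_vertexIdeal {e : Ed} (he : e ≠ τ) :
    gen K E (ghost e) ∈ vertexIdeal K E {E.s τ}ᶜ := by
  rw [← (isCuntzKriegerFamily_gen K E).range_ghost]
  exact (vertexIdeal K E _).mul_mem_right _ _ (ofVert_mem_vertexIdeal K fun h => he (hτ.2 e h))

theorem ghost_mul_ofEdge_sub_one_mem_vertexIdeal :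
    gen K E (ghost τ) * ofEdge K E τ - 1 ∈ vertexIdeal K E {E.s τ}ᶜ := by
  rw [ofEdge, (isCuntzKriegerFamily_gen K E).ghost_edge_self, ← hτ.1, ← neg_sub]
  exact (vertexIdeal K E _).neg_mem (one_sub_ofVert_mem_vertexIdeal K _)

theorem ofEdge_mul_ghost_sub_one_mem_vertexIdeal (hfin : (E.s ⁻¹' {E.s τ}).Finite) :
    ofEdge K E τ * gen K E (ghost τ) - 1 ∈ vertexIdeal K E {E.s τ}ᶜ := by
  classical
  have hsum := (isCuntzKriegerFamily_gen K E).regular_vert _ hfin ⟨τ, rfl⟩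
  rw [← Finset.add_sum_erase _ _ (hfin.mem_toFinset.2 rfl)] at hsum
  have others : ∑ e ∈ hfin.toFinset.erase τ, gen K E (edge e) * gen K E (ghost e) ∈
      vertexIdeal K E {E.s τ}ᶜ := sum_mem fun e he =>
    (vertexIdeal K E _).mul_mem_left _ _ (ghost_mem_vertexIdeal K hτ (Finset.ne_of_mem_erase he))
  have h : ofEdge K E τ * gen K E (ghost τ) - 1 =
      -((1 - ofVert K E (E.s τ)) + ∑ e ∈ hfin.toFinset.erase τ,
        gen K E (edge e) * gen K E (ghost e)) := by
    rw [ofVert, hsum, ofEdge]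
    abel
  rw [h]
  exact neg_mem (add_mem (one_sub_ofVert_mem_vertexIdeal K _) others)

theorem gen_mem_vertexIdeal_or (g : LeavittGen V Ed) :
    gen K E g ∈ vertexIdeal K E {E.s τ}ᶜ ∨ g = vert (E.s τ) ∨ g = edge τ ∨ g = ghost τ := by
  cases g with
  | vert a =>
    by_cases h : a = E.s τ
    · exact .inr (.inl (h ▸ rfl))
    · exact .inl (ofVert_mem_vertexIdeal K h)
  | edge e =>
    by_cases h : e = τ
    · exact .inr (.inr (.inl (h ▸ rfl)))
    · exact .inl (ofEdge_mem_vertexIdeal K hτ h)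
  | ghost e =>
    by_cases h : e = τ
    · exact .inr (.inr (.inr (h ▸ rfl)))
    · exact .inl (ghost_mem_vertexIdeal K hτ h)

theorem exists_pow_mul_gen_mul_sub_aeval_mem (hfin : (E.s ⁻¹' {E.s τ}).Finite)
    (g : LeavittGen V Ed) {a : LeavittPathAlgebra K E} {n : ℕ} {p : Polynomial K}
    (h : ofEdge K E τ ^ n * a - Polynomial.aeval (ofEdge K E τ) p ∈ vertexIdeal K E {E.s τ}ᶜ) :
    ∃ (m : ℕ) (q : Polynomial K), ofEdge K E τ ^ m * (gen K E g * a) -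
      Polynomial.aeval (ofEdge K E τ) q ∈ vertexIdeal K E {E.s τ}ᶜ := by
  set I := vertexIdeal K E {E.s τ}ᶜ
  set t := ofEdge K E τ
  obtain hg | rfl | rfl | rfl := gen_mem_vertexIdeal_or K hτ g
  · refine ⟨0, 0, ?_⟩
    rw [map_zero, sub_zero]
    exact I.mul_mem_left _ _ (I.mul_mem_right _ _ hg)
  · refine ⟨n, p, ?_⟩
    have key : t ^ n * (ofVert K E (E.s τ) * a) - Polynomial.aeval t p =
        (t ^ n * a - Polynomial.aeval t p) - t ^ n * (1 - ofVert K E (E.s τ)) * a := by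
      noncomm_ring
    exact key ▸ sub_mem h (I.mul_mem_right _ _ (I.mul_mem_left _ _
      (one_sub_ofVert_mem_vertexIdeal K _)))
  · refine ⟨n, Polynomial.X * p, ?_⟩
    have key : t ^ n * (t * a) - Polynomial.aeval t (Polynomial.X * p) =
        t * (t ^ n * a - Polynomial.aeval t p) := by
      rw [map_mul, Polynomial.aeval_X, mul_sub, ← mul_assoc, ← mul_assoc, ← pow_succ, pow_succ']
    exact key ▸ I.mul_mem_left _ _ h
  · refine ⟨n + 1, p, ?_⟩
    have key : t ^ (n + 1) * (gen K E (ghost τ) * a) - Polynomial.aeval t p =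
        (t ^ n * a - Polynomial.aeval t p) + t ^ n * (t * gen K E (ghost τ) - 1) * a := by
      rw [pow_succ]
      noncomm_ring
    exact key ▸ add_mem h (I.mul_mem_right _ _ (I.mul_mem_left _ _
      (ofEdge_mul_ghost_sub_one_mem_vertexIdeal K hτ hfin)))

theorem exists_pow_mul_sub_aeval_mem_vertexIdeal (hfin : (E.s ⁻¹' {E.s τ}).Finite)
    (a : LeavittPathAlgebra K E) :
    ∃ (n : ℕ) (p : Polynomial K), ofEdge K E τ ^ n * a - Polynomial.aeval (ofEdge K E τ) p ∈
      vertexIdeal K E {E.s τ}ᶜ := by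
  induction a using LeavittPathAlgebra.induction with
  | zero => exact ⟨0, 0, by simp⟩
  | add a b ha hb =>
    obtain ⟨n, p, hp⟩ := ha
    obtain ⟨m, q, hq⟩ := hb
    refine ⟨n + m, Polynomial.X ^ m * p + Polynomial.X ^ n * q, ?_⟩
    convert add_mem ((vertexIdeal K E _).mul_mem_left (ofEdge K E τ ^ m) _ hp)
      ((vertexIdeal K E _).mul_mem_left (ofEdge K E τ ^ n) _ hq) using 1
    simp only [map_add, map_mul, map_pow, Polynomial.aeval_X, mul_sub, mul_add, ← mul_assoc,
      ← pow_add, add_comm m n]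
    abel
  | smul c a ha =>
    obtain ⟨n, p, hp⟩ := ha
    refine ⟨n, c • p, ?_⟩
    rw [mul_smul_comm, map_smul, ← smul_sub]
    exact (vertexIdealAlgebra K E _).smul_mem' c hp
  | gen g =>
    have hone : ofEdge K E τ ^ 0 * 1 - Polynomial.aeval (ofEdge K E τ) (1 : Polynomial K) ∈
        vertexIdeal K E {E.s τ}ᶜ := by simp
    simpa only [mul_one] using exists_pow_mul_gen_mul_sub_aeval_mem K hτ hfin g hone
  | gen_mul g a ha =>
    obtain ⟨n, p, hp⟩ := ha
    exact exists_pow_mul_gen_mul_sub_aeval_mem K hτ hfin g hp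

theorem gen_mul_ofEdge_sq_eq_zero_or (g : LeavittGen V Ed) :
    gen K E g * ofEdge K E τ ^ 2 = 0 ∨ ∃ k, gen K E g * ofEdge K E τ ^ 2 = ofEdge K E τ ^ k := by
  have loop_mul : ofVert K E (E.s τ) * ofEdge K E τ = ofEdge K E τ :=
    (isCuntzKriegerFamily_gen K E).source_edge τ
  rw [pow_two, ← mul_assoc]
  cases g with
  | vert a =>
    by_cases h : a = E.s τ
    · exact .inr ⟨2, by rw [h, ← ofVert, loop_mul, pow_two]⟩
    · exact .inl (by rw [← ofVert, ofVert_mul_ofEdge_of_ne K h, zero_mul])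
  | edge e =>
    by_cases h : e = τ
    · exact .inr ⟨3, by rw [h, ← ofEdge, pow_succ, pow_two]⟩
    · exact .inl (by rw [← ofEdge, ofEdge_mul_ofEdge_of_ne K fun h' => h (hτ.2 e h'), zero_mul])
  | ghost e =>
    by_cases h : e = τ
    · refine .inr ⟨1, ?_⟩
      rw [h, ofEdge, (isCuntzKriegerFamily_gen K E).ghost_edge_self, ← hτ.1, ← ofVert, ← ofEdge,
        loop_mul, pow_one]
    · exact .inl (by rw [ofEdge, (isCuntzKriegerFamily_gen K E).ghost_edge_ne e τ h, zero_mul])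

theorem exists_mul_mul_pow_eq_zero (a : LeavittPathAlgebra K E) {z : LeavittPathAlgebra K E}
    {n : ℕ} (hz : z * ofEdge K E τ ^ n = 0) : ∃ m : ℕ, z * a * ofEdge K E τ ^ m = 0 := by
  have gen_case (g : LeavittGen V Ed) {z : LeavittPathAlgebra K E} {n : ℕ}
      (hz : z * ofEdge K E τ ^ n = 0) : z * gen K E g * ofEdge K E τ ^ (2 + n) = 0 := by
    rw [pow_add, mul_assoc, ← mul_assoc (gen K E g)]
    obtain h | ⟨k, h⟩ := gen_mul_ofEdge_sq_eq_zero_or K hτ g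
    · rw [h, zero_mul, mul_zero]
    · rw [h, ← pow_add, add_comm, pow_add, ← mul_assoc, hz, zero_mul]
  induction a using LeavittPathAlgebra.induction generalizing z n with
  | zero => exact ⟨0, by simp⟩
  | add a b ha hb =>
    obtain ⟨k, hk⟩ := ha hz
    obtain ⟨l, hl⟩ := hb hz
    refine ⟨k + l, ?_⟩
    rw [mul_add, add_mul, pow_add, ← mul_assoc, hk, zero_mul, zero_add, ← pow_add, add_comm k,
      pow_add, ← mul_assoc, hl, zero_mul]
  | smul c a ha =>
    exact (ha hz).imp fun m hm => by rw [mul_smul_comm, smul_mul_assoc, hm, smul_zero]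
  | gen g => exact ⟨2 + n, gen_case g hz⟩
  | gen_mul g a ha =>
    obtain ⟨m, hm⟩ := ha (gen_case g hz)
    exact ⟨m, by rw [← mul_assoc, hm]⟩

theorem exists_mul_pow_eq_zero_of_mem_vertexIdeal {z : LeavittPathAlgebra K E}
    (hz : z ∈ vertexIdeal K E {E.s τ}ᶜ) : ∃ n : ℕ, z * ofEdge K E τ ^ n = 0 := by
  have rho_mul : vertexSum K E {E.s τ}ᶜ * ofEdge K E τ ^ 1 = 0 := by
    rw [vertexSum, Finset.sum_mul, pow_one]
    exact Finset.sum_eq_zero fun v hv =>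
      ofVert_mul_ofEdge_of_ne K ((Set.toFinite _).mem_toFinset.1 hv)
  replace hz := mem_span_singleton_iff_mem_closure.1 hz
  induction hz using AddSubgroup.closure_induction with
  | mem z hz =>
    obtain ⟨a, c, rfl⟩ := hz
    obtain ⟨n, hn⟩ := exists_mul_mul_pow_eq_zero K hτ c rho_mul
    exact ⟨n, by rw [mul_assoc a, mul_assoc, hn, mul_zero]⟩
  | zero => exact ⟨0, zero_mul _⟩
  | add x y _ _ hx hy =>
    obtain ⟨k, hk⟩ := hx
    obtain ⟨l, hl⟩ := hy
    refine ⟨k + l, ?_⟩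
    rw [add_mul, pow_add, ← mul_assoc, hk, zero_mul, zero_add, ← pow_add, add_comm k, pow_add,
      ← mul_assoc, hl, zero_mul]
  | neg x _ hx => exact hx.imp fun n hn => by rw [neg_mul, hn, neg_zero]

end SourceLoop

end LeavittPathAlgebra

end

theorem proposition2p1_general {K : Type u} [Field K] {V : Type v} {Ed : Type w} [Finite V]
    (E : DirectedGraph V Ed) (τ : Ed) (hτ : E.IsSourceLoop τ)
    (hfin : (E.s ⁻¹' {E.s τ}).Finite) :
    (∃ (F₀ : Type (max v w)) (F₁ : Type w) (F : DirectedGraph F₀ F₁)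
      (f : LeavittPathAlgebra K F →ₙₐ[K] LeavittPathAlgebra.vertexIdealAlgebra K E {E.s τ}ᶜ),
      Function.Bijective f) ∧
    Nonempty
      (UnitaryModuleCat.{max u v w, max u v w}
          (LeavittPathAlgebra.vertexIdealAlgebra K E {E.s τ}ᶜ) ≌
        ModuleCat.{max u v w} (LeavittPathAlgebra K (E.restrict {E.s τ}ᶜ hτ.hereditary))) ∧
    Nonempty
      ({J : Ideal (LeavittPathAlgebra K E) //
          J ≤ (LeavittPathAlgebra.vertexIdeal K E {E.s τ}ᶜ).asIdeal} ≃o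
        Submodule (LeavittPathAlgebra K (E.restrict {E.s τ}ᶜ hτ.hereditary))
          (LeavittPathAlgebra.vertexSumIdeal K E {E.s τ}ᶜ)) ∧
    (∀ J : Ideal (LeavittPathAlgebra K E),
      (LeavittPathAlgebra.vertexIdeal K E {E.s τ}ᶜ).asIdeal < J →
        ∃ p : Polynomial K, p.eval 0 = 1 ∧
          J = Ideal.span {Polynomial.aeval (LeavittPathAlgebra.ofEdge K E τ) p}) := by
  refine ⟨⟨_, _, _, LeavittPathAlgebra.hedgehogToVertexIdeal K hτ.hereditary,
      LeavittPathAlgebra.bijective_hedgehogToVertexIdeal K hτ.hereditary⟩,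
    LeavittPathAlgebra.nonempty_unitaryModuleCat_equivalence K hτ.hereditary,
    ⟨LeavittPathAlgebra.leftIdealOrderIso K hτ.hereditary⟩, fun J hJ => ?_⟩
  exact exists_eq_span_aeval_of_lt
    (LeavittPathAlgebra.ghost_mul_ofEdge_sub_one_mem_vertexIdeal K hτ)
    (LeavittPathAlgebra.exists_pow_mul_sub_aeval_mem_vertexIdeal K hτ hfin)
    (fun _ => LeavittPathAlgebra.exists_mul_pow_eq_zero_of_mem_vertexIdeal K hτ) hJ

theorem proposition2p1 {K : Type u} [Field K] {V : Type v} {Ed : Type w} [Finite V] [Finite Ed]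
    (E : DirectedGraph V Ed) (τ : Ed) (hτ : E.IsSourceLoop τ) :
    -- `I` is isomorphic, as a `K`-algebra, to a Leavitt path algebra
    (∃ (F₀ : Type (max v w)) (F₁ : Type w) (F : DirectedGraph F₀ F₁)
      (f : LeavittPathAlgebra K F →ₙₐ[K] LeavittPathAlgebra.vertexIdealAlgebra K E {E.s τ}ᶜ),
      Function.Bijective f) ∧
    -- `I` is Morita equivalent to `L_K(E_H)`
    Nonempty
      (UnitaryModuleCat.{max u v w, max u v w}
          (LeavittPathAlgebra.vertexIdealAlgebra K E {E.s τ}ᶜ) ≌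
        ModuleCat.{max u v w} (LeavittPathAlgebra K (E.restrict {E.s τ}ᶜ hτ.hereditary))) ∧
    -- the left ideals contained in `I` and the `L_K(E_H)`-submodules of `ρI`
    Nonempty
      ({J : Ideal (LeavittPathAlgebra K E) //
          J ≤ (LeavittPathAlgebra.vertexIdeal K E {E.s τ}ᶜ).asIdeal} ≃o
        Submodule (LeavittPathAlgebra K (E.restrict {E.s τ}ᶜ hτ.hereditary))
          (LeavittPathAlgebra.vertexSumIdeal K E {E.s τ}ᶜ)) ∧
    -- the left ideals properly containing `I`
    (∀ J : Ideal (LeavittPathAlgebra K E),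
      (LeavittPathAlgebra.vertexIdeal K E {E.s τ}ᶜ).asIdeal < J →
        ∃ p : Polynomial K, p.eval 0 = 1 ∧
          J = Ideal.span {Polynomial.aeval (LeavittPathAlgebra.ofEdge K E τ) p}) :=
  proposition2p1_general E τ hτ (Set.toFinite _)
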